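/- **Conventions.** For $M\in\mathbb R^{n\times m}$ and $p,r\in[1,\infty]$ let $\|M\|_{p,r}$ be the $\ell_r$-norm of the vector of $\ell_p$-norms of the rows of $M$; $\|M\|_{\max}=\|M\|_{\infty,\infty}$ and $\|M\|_F=\|M\|_{2,2}$. A tug-of-war matrix $S\in\mathbb R^{c\times q}$ has entries $S_{ij}=h_i(j)/\sqrt c$, where $h_1,\dots,h_c:[q]\to\{-1,1\}$ are independent and uniformly random. Time is measured in the circuit model: algorithms are fixed arithmetic circuits that depend only on the dimensions $n,q,m,c$ and not on the entries of the matrices; they compute with exact real numbers, writing a real constant or performing one operation $+,-,\times,\div$ costs one unit of time, and so does drawing one random sign. A real number $\omega\in[2,3]$ is called an exponent of matrix multiplication if for all $k$ two real $k\times k$ matrices can be multiplied in time $O(k^{\omega})$ in this model. **Theorem (classical tug-of-war algorithm, 2 matrices).** There is an absolute constant $\kappa>0$, and for every exponent of matrix multiplication $\omega\in[2,3]$ there is a constant $K>0$ depending only on $\omega$, such that the following holds for all $n,q,m\ge1$, $A\in\mathbb R^{n\times q}$, $B\in\mathbb R^{q\times m}$, $\varepsilon>0$ and $\delta\in(0,1)$.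 *Max-norm.* Let $X=\max\{1,\ \|A\|_{2,\infty}^2\|B^T\|_{2,\infty}^2/\varepsilon^2\}$, $c=\lceil\kappa X\log(2nm/\delta)\rceil$ and $$T=K\,(mn+nq+qm)\,\bigl(X\log(2nm/\delta)\bigr)^{\omega-2}.$$ Let $S\in\mathbb R^{c\times q}$ be a single tug-of-war matrix. Then, with probability at least $1-\delta$, $C=AS^TSB$ satisfies $\|C-AB\|_{\max}\le\varepsilon$. If $c\le\min\{n,q,m\}$ or $\omega=3$, then sampling $S$ and computing $C=AS^TSB$ takes time at most $T$. If $c>\min\{n,q,m\}$, then even $C=AB$ can be computed exactly in time at most $T$. *Frobenius norm.* The same holds, with the conclusion $\|C-AB\|_F\le\varepsilon$, for $X=\max\{1,\ \|A\|_F^2\|B\|_F^2/\varepsilon^2\}$, $c=\lceil\kappa X\log(2/\delta)\rceil$ and $$T=K\,(mn+nq+qm)\,X^{\omega-2}\,\log(2/\delta).$$ -/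

import Mathlib

namespace TugOfWar

noncomputable section

/-- The element-wise matrix norm `‖M‖_{p,q}`: the `ℓ_q` norm of the vector of `ℓ_p` norms
of the rows of `M`. The exponent `∞` is written `⊤`. -/
def entryNorm (p q : ENNReal) {n m : ℕ} (M : Matrix (Fin n) (Fin m) ℝ) : ℝ :=
  ‖(WithLp.toLp q (fun i => ‖(WithLp.toLp p (M i) : PiLp p (fun _ : Fin m => ℝ))‖) :
    PiLp q (fun _ : Fin n => ℝ))‖

/-- The max-norm `‖M‖_{∞,∞}`. -/
def maxNorm {n m : ℕ} (M : Matrix (Fin n) (Fin m) ℝ) : ℝ := entryNorm ⊤ ⊤ M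

/-- The Frobenius norm `‖M‖_{2,2}`. -/
def frobNorm {n m : ℕ} (M : Matrix (Fin n) (Fin m) ℝ) : ℝ := entryNorm 2 2 M

/-- The `c × q` sketch matrix with entries `h i j / √c`, where each `h i j` is `1` or `-1`. -/
def sketch {c q : ℕ} (h : Fin c → Fin q → ℤˣ) : Matrix (Fin c) (Fin q) ℝ :=
  Matrix.of fun i j => ((h i j : ℤ) : ℝ) / √(c : ℝ)

/-- The probability of an event about the sign functions `h 1, …, h c : [q] → {1, -1}` when
they are drawn independently and uniformly at random. -/
def signProb (c q : ℕ) (E : Set (Fin c → Fin q → ℤˣ)) : ENNReal :=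
  (PMF.uniformOfFintype (Fin c → Fin q → ℤˣ)).toOuterMeasure E

/-! ### Arithmetic circuits over the reals

The values of the gates are exact real numbers, and every gate costs one unit of time. -/

/-- The four arithmetic operations. -/
inductive ArithOp where
  | add
  | sub
  | mul
  | div

/-- The result of an arithmetic operation; a division by zero has no result. -/
def ArithOp.apply : ArithOp → ℝ → ℝ → Option ℝ
  | .add, a, b => some (a + b)
  | .sub, a, b => some (a - b)
  | .mul, a, b => some (a * b)
  | .div, a, b => if b = 0 then none else some (a / b)

/-- A wire carries an input or the value of an earlier gate (gates are numbered from `0`). -/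
inductive Wire (ι : Type) where
  | input (i : ι)
  | gate (k : ℕ)

/-- A gate writes a real constant or applies an arithmetic operation to two wires. -/
inductive Gate (ι : Type) where
  | const (r : ℝ)
  | op (o : ArithOp) (u v : Wire ι)

/-- An arithmetic circuit with inputs indexed by `ι` and outputs indexed by `κ`: a list of gates
in order of evaluation, and a wire for each output. -/
structure Circuit (ι κ : Type) where
  gates : List (Gate ι)
  output : κ → Wire ι

/-- The value on a wire, given the inputs and the values of the gates evaluated so far;
there is none if the wire refers to a gate that has not been evaluated. -/
def Wire.read {ι : Type} (x : ι → ℝ) (mem : List ℝ) : Wire ι → Option ℝ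
  | .input i => some (x i)
  | .gate k => mem[k]?

/-- The value of a gate, given the inputs and the values of the gates evaluated so far. -/
def Gate.value {ι : Type} (x : ι → ℝ) (mem : List ℝ) : Gate ι → Option ℝ
  | .const r => some r
  | .op o u v => (u.read x mem).bind fun a => (v.read x mem).bind fun b => o.apply a b

/-- The list of the values of all gates; there is none if some gate has no value. -/
def Circuit.run {ι κ : Type} (Γ : Circuit ι κ) (x : ι → ℝ) : Option (List ℝ) :=
  Γ.gates.foldlM (fun mem g => (g.value x mem).map fun v => mem ++ [v]) []

/-- On input `x` every gate of the circuit has a value, and the outputs are `y`. -/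
def Circuit.Returns {ι κ : Type} (Γ : Circuit ι κ) (x : ι → ℝ) (y : κ → ℝ) : Prop :=
  ∃ mem : List ℝ, Γ.run x = some mem ∧ ∀ o : κ, (Γ.output o).read x mem = some (y o)

/-- The number of gates. -/
def Circuit.size {ι κ : Type} (Γ : Circuit ι κ) : ℕ := Γ.gates.length

/-- The list of entries of a matrix. -/
def entries {n m : ℕ} (M : Matrix (Fin n) (Fin m) ℝ) : Fin n × Fin m → ℝ := fun p => M p.1 p.2

/-- One fixed circuit computes `A B` for all real `n × q` matrices `A` and `q × m` matrices `B`
in time at most `T`. -/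
def ProductInTime (n q m : ℕ) (T : ℝ) : Prop :=
  ∃ Γ : Circuit ((Fin n × Fin q) ⊕ (Fin q × Fin m)) (Fin n × Fin m),
    (∀ (A : Matrix (Fin n) (Fin q) ℝ) (B : Matrix (Fin q) (Fin m) ℝ),
      Γ.Returns (Sum.elim (entries A) (entries B)) (entries (A * B))) ∧
    (Γ.size : ℝ) ≤ T

/-- One fixed circuit, whose inputs are `A`, `B` and the `c * q` random signs of the sketch `S`,
computes `A Sᵀ S B` for all `A`, `B` and all outcomes of the signs, in time at most `T`.
Drawing one random sign costs one unit of time, like a gate. -/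
def SketchedProductInTime (n q m c : ℕ) (T : ℝ) : Prop :=
  ∃ Γ : Circuit ((Fin n × Fin q) ⊕ (Fin q × Fin m) ⊕ (Fin c × Fin q)) (Fin n × Fin m),
    (∀ (A : Matrix (Fin n) (Fin q) ℝ) (B : Matrix (Fin q) (Fin m) ℝ) (h : Fin c → Fin q → ℤˣ),
      Γ.Returns
        (Sum.elim (entries A) (Sum.elim (entries B) fun p => ((h p.1 p.2 : ℤ) : ℝ)))
        (entries (A * (sketch h).transpose * sketch h * B))) ∧
    (Γ.size : ℝ) + (c : ℝ) * q ≤ T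

/-- `ω` is an exponent of matrix multiplication: two `k × k` matrices can be multiplied in time
`O(k ^ ω)`. -/
def IsMatMulExponent (ω : ℝ) : Prop :=
  ∃ K : ℝ, ∀ k : ℕ, ProductInTime k k k (K * (k : ℝ) ^ ω)

end

end TugOfWar

open TugOfWar

/-! Accuracy. Each entry of `C - AB` is an average of `c` independent centred errors `⟨g,a⟩⟨g,b⟩ -
⟨a,b⟩`, where `g` is a random sign vector, `a` a row of `A` and `b` a column of `B`. If `a` and `b`
have norm at most 1, such an error is sub-exponential: `⟨g,a⟩²/4` has a bounded exponential moment
(`expect_exp_signSum_sq_le`), which gives a Gaussian-type bound near zero (`expect_exp_signErr_le`).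
Independence multiplies these bounds, and comparing a power with an exponential bounds the `2p`-th
moment of the entry by `2 (const · p/c)^p (‖a‖‖b‖)^(2p)` (`expect_sketch_error_pow_le`). Let `L` be
the logarithm in the definition of `c`. For `p = ⌈L⌉` and `c` about `κXL`, Markov's inequality
bounds the failure probability of an entry by `2 exp(-L)`. In max-norm this is summed over the `nm`
entries, which the `nm` inside `L` pays for. In Frobenius norm, Minkowski's inequality
(`expect_sum_pow_le`) adds up the `p`-th moment norms of the squared entries, so no factor `nm` is
lost.

Time. Rectangular products are cut into square blocks of size `k`. With `k = c` for the sketch, or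
`k` the smallest dimension for the exact product, the blocks multiplied have total area `O(mn + nq +
qm)`, and each unit of area costs `O(k^(ω-2))`. For `ω = 3` blocks of size 1 already give a cost
linear in `c`, whatever the dimensions. -/

namespace TugOfWar

/-! ### Gate lists -/

section Gates

variable {ι κ o : Type}

/-- Evaluate a list of gates on input `x`, starting with the gate values `mem`. -/
noncomputable def evalGates (x : ι → ℝ) (mem : List ℝ) (G : List (Gate ι)) : Option (List ℝ) :=
  G.foldlM (fun mem g => (g.value x mem).map fun v => mem ++ [v]) mem

lemma evalGates_nil (x : ι → ℝ) (mem : List ℝ) : evalGates x mem [] = some mem := rfl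

lemma evalGates_cons (x : ι → ℝ) (mem : List ℝ) (g : Gate ι) (G : List (Gate ι)) :
    evalGates x mem (g :: G) = (g.value x mem).bind fun v => evalGates x (mem ++ [v]) G := by
  unfold evalGates
  rw [List.foldlM_cons]
  cases g.value x mem <;> rfl

lemma evalGates_append (x : ι → ℝ) (mem : List ℝ) (G H : List (Gate ι)) :
    evalGates x mem (G ++ H) = (evalGates x mem G).bind fun mem' => evalGates x mem' H := by
  unfold evalGates
  rw [List.foldlM_append]
  rfl

/-- Memory only grows at its end, so a wire keeps its value when gates are added, and new gate
numbers are shifted by the number of old gates. -/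
lemma evalGates_prefix {x : ι → ℝ} {G : List (Gate ι)} {mem mem' : List ℝ}
    (h : evalGates x mem G = some mem') : ∃ l, mem' = mem ++ l ∧ l.length = G.length := by
  induction G generalizing mem with
  | nil =>
    rw [evalGates_nil, Option.some_inj] at h
    exact ⟨[], by simp [h]⟩
  | cons g G ih =>
    rw [evalGates_cons, Option.bind_eq_some_iff] at h
    obtain ⟨v, -, h⟩ := h
    obtain ⟨l, rfl, hl⟩ := ih h
    exact ⟨v :: l, by simp [hl]⟩

lemma Wire.read_append {x : ι → ℝ} {mem : List ℝ} {w : Wire ι} {v : ℝ}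
    (h : w.read x mem = some v) (l : List ℝ) : w.read x (mem ++ l) = some v := by
  cases w with
  | input i => exact h
  | gate k =>
    simp only [Wire.read] at h ⊢
    rw [List.getElem?_append_left (List.getElem?_eq_some_iff.1 h).1, h]

/-- The gate list has a value on every input. -/
def Total (G : List (Gate ι)) : Prop := ∀ x, ∃ mem, evalGates x [] G = some mem

/-- The function `f` of the inputs is carried by a wire after evaluation of `G`. -/
def Available (G : List (Gate ι)) (f : (ι → ℝ) → ℝ) : Prop :=
  ∃ w : Wire ι, ∀ x, ∃ mem, evalGates x [] G = some mem ∧ w.read x mem = some (f x)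

lemma Available.append {G H : List (Gate ι)} {f : (ι → ℝ) → ℝ} (h : Available G f)
    (ht : Total (G ++ H)) : Available (G ++ H) f := by
  obtain ⟨w, hw⟩ := h
  refine ⟨w, fun x => ?_⟩
  obtain ⟨mem, hm, hr⟩ := hw x
  obtain ⟨mem', hm'⟩ := ht x
  refine ⟨mem', hm', ?_⟩
  rw [evalGates_append, hm, Option.bind_some] at hm'
  obtain ⟨l, rfl, -⟩ := evalGates_prefix hm'
  exact Wire.read_append hr l

/-! ### Relocation of gate lists -/

/-- Substitute wires for the inputs and shift the gate numbers. -/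
def Wire.subst (σ : κ → Wire ι) (s : ℕ) : Wire κ → Wire ι
  | .input i => σ i
  | .gate k => .gate (s + k)

/-- Substitute wires for the inputs of a gate and shift the gate numbers. -/
def Gate.subst (σ : κ → Wire ι) (s : ℕ) : Gate κ → Gate ι
  | .const r => .const r
  | .op a u v => .op a (u.subst σ s) (v.subst σ s)

lemma Wire.read_subst {σ : κ → Wire ι} {x : ι → ℝ} {y : κ → ℝ} {m₀ : List ℝ}
    (hσ : ∀ i, (σ i).read x m₀ = some (y i)) (w : Wire κ) (mem : List ℝ) :
    (w.subst σ m₀.length).read x (m₀ ++ mem) = w.read y mem := by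
  cases w with
  | input i => exact Wire.read_append (hσ i) mem
  | gate k =>
    simp only [Wire.subst, Wire.read]
    rw [List.getElem?_append_right (Nat.le_add_right _ _), Nat.add_sub_cancel_left]

lemma Gate.value_subst {σ : κ → Wire ι} {x : ι → ℝ} {y : κ → ℝ} {m₀ : List ℝ}
    (hσ : ∀ i, (σ i).read x m₀ = some (y i)) (g : Gate κ) (mem : List ℝ) :
    (g.subst σ m₀.length).value x (m₀ ++ mem) = g.value y mem := by
  cases g with
  | const r => rfl
  | op a u v => simp only [Gate.subst, Gate.value, Wire.read_subst hσ]

lemma evalGates_subst {σ : κ → Wire ι} {x : ι → ℝ} {y : κ → ℝ} {m₀ : List ℝ}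
    (hσ : ∀ i, (σ i).read x m₀ = some (y i)) (G : List (Gate κ)) (mem : List ℝ) :
    evalGates x (m₀ ++ mem) (G.map (Gate.subst σ m₀.length)) =
      (evalGates y mem G).map (m₀ ++ ·) := by
  induction G generalizing mem with
  | nil => rfl
  | cons g G ih =>
    rw [List.map_cons, evalGates_cons, evalGates_cons, Gate.value_subst hσ]
    cases g.value y mem with
    | none => rfl
    | some v => simp only [Option.bind_some, List.append_assoc, ih]

/-! ### Cost of computing functions from given ones -/

/-- Whenever the functions in `F` are available, at most `t` further gates make the functions
in `F'` available. -/
def ComputableFrom (F F' : Set ((ι → ℝ) → ℝ)) (t : ℝ) : Prop :=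
  ∀ G : List (Gate ι), Total G → (∀ f ∈ F, Available G f) →
    ∃ H : List (Gate ι), (H.length : ℝ) ≤ t ∧ Total (G ++ H) ∧ ∀ f ∈ F', Available (G ++ H) f

namespace ComputableFrom

variable {F F' F₁ F₂ : Set ((ι → ℝ) → ℝ)} {s t : ℝ}

lemma of_subset (h : F' ⊆ F) : ComputableFrom F F' 0 := fun G hG hF =>
  ⟨[], by simp, by simpa using hG, fun f hf => by simpa using hF f (h hf)⟩

lemma mono (h : ComputableFrom F₁ F₂ s) (h₁ : F₁ ⊆ F) (h₂ : F' ⊆ F₂) (hst : s ≤ t) :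
    ComputableFrom F F' t := fun G hG hF => by
  obtain ⟨H, hl, hT, hA⟩ := h G hG fun f hf => hF f (h₁ hf)
  exact ⟨H, hl.trans hst, hT, fun f hf => hA f (h₂ hf)⟩

/-- Nothing computed is ever lost, so the second stage may use `F` as well as `F₁`. -/
lemma trans (h₁ : ComputableFrom F F₁ s) (h₂ : ComputableFrom (F ∪ F₁) F₂ t) :
    ComputableFrom F F₂ (s + t) := fun G hG hF => by
  obtain ⟨H, hl, hT, hA⟩ := h₁ G hG hF
  obtain ⟨H', hl', hT', hA'⟩ := h₂ (G ++ H) hT fun f hf =>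
    hf.elim (fun hf => (hF f hf).append hT) (hA f)
  refine ⟨H ++ H', ?_, by rwa [← List.append_assoc], by rwa [← List.append_assoc]⟩
  rw [List.length_append]
  push_cast
  linarith

lemma union (h₁ : ComputableFrom F F₁ s) (h₂ : ComputableFrom F F₂ t) :
    ComputableFrom F (F₁ ∪ F₂) (s + t) := fun G hG hF => by
  obtain ⟨H, hl, hT, hA⟩ := h₁ G hG hF
  obtain ⟨H', hl', hT', hA'⟩ := h₂ (G ++ H) hT fun f hf => (hF f hf).append hT
  refine ⟨H ++ H', ?_, by rwa [← List.append_assoc], ?_⟩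
  · rw [List.length_append]
    push_cast
    linarith
  · rw [← List.append_assoc]
    exact fun f hf => hf.elim (fun hf => (hA f hf).append hT') (hA' f)

lemma iUnion_finset {α : Type*} (S : Finset α) {E : α → Set ((ι → ℝ) → ℝ)}
    (h : ∀ a, ComputableFrom F (E a) t) :
    ComputableFrom F (⋃ a ∈ S, E a) (S.card * t) := by
  classical
  induction S using Finset.induction_on with
  | empty => simpa using of_subset (F := F) (F' := ∅) (Set.empty_subset _)
  | insert a S ha ih =>
    rw [Finset.set_biUnion_insert, Finset.card_insert_of_notMem ha]
    refine ((h a).union ih).mono le_rfl le_rfl (le_of_eq ?_)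
    push_cast
    ring

lemma iUnion {α : Type*} [Fintype α] {E : α → Set ((ι → ℝ) → ℝ)}
    (h : ∀ a, ComputableFrom F (E a) t) :
    ComputableFrom F (⋃ a, E a) (Fintype.card α * t) := by
  simpa using iUnion_finset Finset.univ h

/-- A circuit can be used as a subroutine. -/
lemma circuit (Γ : Circuit κ o) {φ : (κ → ℝ) → o → ℝ} (hΓ : ∀ y, Γ.Returns y (φ y))
    {u : κ → (ι → ℝ) → ℝ} (hu : ∀ i, u i ∈ F) :
    ComputableFrom F (Set.range fun j x => φ (fun i => u i x) j) Γ.size := fun G hG hF => by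
  choose σ hσ using fun i => hF (u i) (hu i)
  -- The wires `σ` are chosen before `x`, so one relocated gate list serves all inputs; only the
  -- memories depend on `x`.
  have key : ∀ x, ∃ m₀ mem, m₀.length = G.length ∧
      evalGates x [] (G ++ Γ.gates.map (Gate.subst σ G.length)) = some (m₀ ++ mem) ∧
      (∀ i, (σ i).read x m₀ = some (u i x)) ∧
      ∀ j, (Γ.output j).read (fun i => u i x) mem = some (φ (fun i => u i x) j) := by
    intro x
    obtain ⟨m₀, hm₀⟩ := hG x
    obtain ⟨l, hl, hlen⟩ := evalGates_prefix hm₀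
    rw [List.nil_append] at hl
    subst hl
    have hread : ∀ i, (σ i).read x m₀ = some (u i x) := fun i => by
      obtain ⟨mem, hm, hr⟩ := hσ i x
      rw [hm₀, Option.some_inj] at hm
      rwa [hm]
    obtain ⟨mem, hrun, hout⟩ := hΓ fun i => u i x
    refine ⟨m₀, mem, hlen, ?_, hread, hout⟩
    rw [evalGates_append, hm₀, Option.bind_some, ← hlen]
    have := evalGates_subst hread Γ.gates []
    rw [List.append_nil] at this
    rw [this, show evalGates (fun i => u i x) [] Γ.gates = some mem from hrun, Option.map_some]
  refine ⟨Γ.gates.map (Gate.subst σ G.length), by simp [Circuit.size], fun x => ?_, ?_⟩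
  · obtain ⟨m₀, mem, -, h, -⟩ := key x
    exact ⟨_, h⟩
  · rintro _ ⟨j, rfl⟩
    refine ⟨(Γ.output j).subst σ G.length, fun x => ?_⟩
    obtain ⟨m₀, mem, hlen, h, hread, hout⟩ := key x
    exact ⟨_, h, by rw [← hlen, Wire.read_subst hread, hout]⟩

lemma const (r : ℝ) : ComputableFrom F {fun _ => r} 1 := by
  have := circuit (F := F) (κ := Empty) (o := Unit) ⟨[.const r], fun _ => .gate 0⟩
    (φ := fun _ _ => r) (fun y => ⟨[r], rfl, fun _ => rfl⟩) (u := nofun) nofun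
  refine this.mono le_rfl ?_ (by simp [Circuit.size])
  rintro _ rfl
  exact ⟨(), rfl⟩

lemma add {f g : (ι → ℝ) → ℝ} (hf : f ∈ F) (hg : g ∈ F) : ComputableFrom F {f + g} 1 := by
  have := circuit (F := F) (κ := Bool) (o := Unit)
    ⟨[.op .add (.input true) (.input false)], fun _ => .gate 0⟩
    (φ := fun y _ => y true + y false) (fun y => ⟨[y true + y false], rfl, fun _ => rfl⟩)
    (u := fun b => cond b f g) (by rintro (_ | _) <;> assumption)
  refine this.mono le_rfl ?_ (by simp [Circuit.size])
  rintro _ rfl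
  exact ⟨(), rfl⟩

lemma mul {f g : (ι → ℝ) → ℝ} (hf : f ∈ F) (hg : g ∈ F) : ComputableFrom F {f * g} 1 := by
  have := circuit (F := F) (κ := Bool) (o := Unit)
    ⟨[.op .mul (.input true) (.input false)], fun _ => .gate 0⟩
    (φ := fun y _ => y true * y false) (fun y => ⟨[y true * y false], rfl, fun _ => rfl⟩)
    (u := fun b => cond b f g) (by rintro (_ | _) <;> assumption)
  refine this.mono le_rfl ?_ (by simp [Circuit.size])
  rintro _ rfl
  exact ⟨(), rfl⟩

lemma exists_circuit {u : o → (ι → ℝ) → ℝ}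
    (h : ComputableFrom (Set.range fun i x => x i) (Set.range u) t) :
    ∃ Γ : Circuit ι o, (∀ x, Γ.Returns x fun j => u j x) ∧ (Γ.size : ℝ) ≤ t := by
  obtain ⟨H, hl, hT, hA⟩ := h [] (fun x => ⟨[], rfl⟩) (by
    rintro _ ⟨i, rfl⟩
    exact ⟨.input i, fun x => ⟨[], rfl, rfl⟩⟩)
  choose w hw using fun j => hA (u j) ⟨j, rfl⟩
  refine ⟨⟨H, w⟩, fun x => ?_, hl⟩
  obtain ⟨mem, hm⟩ := hT x
  refine ⟨mem, hm, fun j => ?_⟩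
  obtain ⟨mem', hm', hr⟩ := hw j x
  rw [hm, Option.some_inj] at hm'
  rw [hm']
  exact hr

end ComputableFrom

/-! ### Block matrix multiplication -/

/-- The set of entries of a matrix. -/
def entrySet {α β R : Type*} (M : Matrix α β R) : Set R := {f | ∃ i j, M i j = f}

lemma entry_mem_entrySet {α β R : Type*} (M : Matrix α β R) (i : α) (j : β) :
    M i j ∈ entrySet M := ⟨i, j, rfl⟩

lemma ComputableFrom.matrix {α β : Type*} [Fintype α] [Fintype β]
    {F : Set ((ι → ℝ) → ℝ)} {t : ℝ} {M : Matrix α β ((ι → ℝ) → ℝ)}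
    (h : ∀ i j, ComputableFrom F {M i j} t) :
    ComputableFrom F (entrySet M) (Fintype.card α * Fintype.card β * t) := by
  refine (ComputableFrom.iUnion (α := α × β) fun p => h p.1 p.2).mono le_rfl ?_ (by simp)
  rintro _ ⟨i, j, rfl⟩
  exact Set.mem_iUnion.2 ⟨(i, j), rfl⟩

/-- Entries are functions of the circuit inputs, so `A * B` is a product over a function ring and
intermediate matrices can be multiplied as easily as inputs. -/
lemma ProductInTime.computableFrom {n q m : ℕ} {T : ℝ} (h : ProductInTime n q m T)
    {F : Set ((ι → ℝ) → ℝ)} {A : Matrix (Fin n) (Fin q) ((ι → ℝ) → ℝ)}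
    {B : Matrix (Fin q) (Fin m) ((ι → ℝ) → ℝ)} (hA : ∀ i j, A i j ∈ F) (hB : ∀ i j, B i j ∈ F) :
    ComputableFrom F (entrySet (A * B)) T := by
  obtain ⟨Γ, hΓ, hT⟩ := h
  have h₁ := ComputableFrom.circuit (F := F) Γ
    (φ := fun y p => ∑ j, y (.inl (p.1, j)) * y (.inr (j, p.2)))
    (fun y => by
      convert hΓ (.of fun i j => y (.inl (i, j))) (.of fun i j => y (.inr (i, j))) using 1
      · ext (p | p) <;> rfl
      · ext p
        simp [entries, Matrix.mul_apply])
    (u := Sum.elim (fun p => A p.1 p.2) (fun p => B p.1 p.2))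
    (by rintro (p | p); exacts [hA _ _, hB _ _])
  refine h₁.mono le_rfl ?_ hT
  rintro _ ⟨i, j, rfl⟩
  refine ⟨(i, j), ?_⟩
  ext x
  simp [Matrix.mul_apply]

lemma sum_range_blocks {R : Type*} [AddCommMonoid R] (f : ℕ → R) (k t : ℕ) :
    ∑ J ∈ Finset.range t, ∑ j : Fin k, f (J * k + j) = ∑ j ∈ Finset.range (t * k), f j := by
  induction t with
  | zero => simp
  | succ t ih =>
    rw [Finset.sum_range_succ, ih, Nat.succ_mul, Finset.sum_range_add,
      ← Fin.sum_univ_eq_sum_range (fun x => f (t * k + x))]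

/-- The matrix continued by zero. -/
def padZero {R : Type*} [Zero R] {a b : ℕ} (A : Matrix (Fin a) (Fin b) R) (i j : ℕ) : R :=
  if h : i < a ∧ j < b then A ⟨i, h.1⟩ ⟨j, h.2⟩ else 0

lemma mul_eq_sum_padZero {R : Type*} [NonUnitalNonAssocSemiring R] {a b d : ℕ}
    (A : Matrix (Fin a) (Fin b) R) (B : Matrix (Fin b) (Fin d) R) (i : Fin a) (l : Fin d) {N : ℕ}
    (hN : b ≤ N) : (A * B) i l = ∑ j ∈ Finset.range N, padZero A i j * padZero B j l := by
  rw [← Finset.sum_subset (Finset.range_subset_range.2 hN), Finset.sum_range, Matrix.mul_apply]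
  · refine Finset.sum_congr rfl fun j _ => ?_
    simp [padZero]
  · intro j _ hj
    rw [Finset.mem_range, not_lt] at hj
    simp [padZero, hj.not_gt]

/-- Multiplication of rectangular matrices in blocks of size `k`. -/
lemma ComputableFrom.matrix_mul {k : ℕ} {T : ℝ} (hk : 0 < k) (hT : ProductInTime k k k T)
    {a b d a' b' d' : ℕ} (ha : a ≤ a' * k) (hb : b ≤ b' * k) (hd : d ≤ d' * k)
    {F : Set ((ι → ℝ) → ℝ)} {A : Matrix (Fin a) (Fin b) ((ι → ℝ) → ℝ)}
    {B : Matrix (Fin b) (Fin d) ((ι → ℝ) → ℝ)} (hA : ∀ i j, A i j ∈ F) (hB : ∀ i j, B i j ∈ F)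
    (h0 : 0 ∈ F) :
    ComputableFrom F (entrySet (A * B)) (a' * d' * (b' * (T + k ^ 2))) := by
  have hA' : ∀ i j, padZero A i j ∈ F := fun i j => by
    unfold padZero
    split_ifs
    exacts [hA _ _, h0]
  have hB' : ∀ i j, padZero B i j ∈ F := fun i j => by
    unfold padZero
    split_ifs
    exacts [hB _ _, h0]
  -- Block `(I, L)` of the product after `t` block products. Each further one costs `T`, plus `k ^
  -- 2` additions to accumulate it; both the empty sum and the padding use the available zero.
  let S : ℕ → ℕ → ℕ → Matrix (Fin k) (Fin k) ((ι → ℝ) → ℝ) := fun t I L i l =>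
    ∑ J ∈ Finset.range t, ∑ j : Fin k, padZero A (I * k + i) (J * k + j) *
      padZero B (J * k + j) (L * k + l)
  have hS : ∀ t I L, ComputableFrom F (entrySet (S t I L)) (t * (T + k ^ 2)) := by
    intro t I L
    induction t with
    | zero =>
      refine (ComputableFrom.of_subset ?_).mono le_rfl le_rfl (by simp)
      rintro _ ⟨i, l, rfl⟩
      simpa [S] using h0
    | succ t ih =>
      have h₁ := ih.union (hT.computableFrom (F := F)
        (A := .of fun i j => padZero A (I * k + i) (t * k + j))
        (B := .of fun i j => padZero B (t * k + i) (L * k + j)) (fun _ _ => hA' _ _) (fun _ _ => hB' _ _))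
      have h₂ := h₁.trans (ComputableFrom.matrix (M := S (t + 1) I L) (t := 1) fun i l => by
        have : S (t + 1) I L i l = S t I L i l + ((.of fun i j => padZero A (I * k + i) (t * k + j) :
          Matrix (Fin k) (Fin k) ((ι → ℝ) → ℝ)) *
            (.of fun i j => padZero B (t * k + i) (L * k + j) :
              Matrix (Fin k) (Fin k) ((ι → ℝ) → ℝ))) i l := by
          simp only [S, Finset.sum_range_succ, Matrix.mul_apply, Matrix.of_apply]
        rw [this]
        exact ComputableFrom.add (.inr (.inl (entry_mem_entrySet _ _ _)))
          (.inr (.inr (entry_mem_entrySet _ _ _))))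
      refine h₂.mono le_rfl le_rfl (le_of_eq ?_)
      simp only [Fintype.card_fin]
      push_cast
      ring
  refine (ComputableFrom.iUnion (α := Fin a' × Fin d') fun p => hS b' p.1 p.2).mono le_rfl ?_
    (by simp)
  rintro _ ⟨i, l, rfl⟩
  -- Quotients by `k` locate the block, remainders the position inside it.
  refine Set.mem_iUnion.2 ⟨(⟨i / k, ?_⟩, ⟨l / k, ?_⟩), ⟨i % k, Nat.mod_lt _ hk⟩,
    ⟨l % k, Nat.mod_lt _ hk⟩, ?_⟩
  · exact (Nat.div_lt_iff_lt_mul hk).2 (i.2.trans_le ha)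
  · exact (Nat.div_lt_iff_lt_mul hk).2 (l.2.trans_le hd)
  · rw [mul_eq_sum_padZero A B i l hb, ← sum_range_blocks]
    simp only [S, Nat.div_add_mod']

lemma ProductInTime.of_blocks {k : ℕ} {T : ℝ} (hk : 0 < k) (hT : ProductInTime k k k T)
    {a b d a' b' d' : ℕ} (ha : a ≤ a' * k) (hb : b ≤ b' * k) (hd : d ≤ d' * k) :
    ProductInTime a b d (1 + a' * d' * (b' * (T + k ^ 2))) := by
  obtain ⟨Γ, hΓ, hs⟩ := ((ComputableFrom.const 0).trans (ComputableFrom.matrix_mul hk hT ha hb hd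
    (F := Set.range (fun (i : (Fin a × Fin b) ⊕ (Fin b × Fin d)) x => x i) ∪ {fun _ => 0})
    (A := .of fun i j x => x (.inl (i, j))) (B := .of fun i j x => x (.inr (i, j)))
    (fun i j => .inl ⟨_, rfl⟩) (fun i j => .inl ⟨_, rfl⟩) (.inr rfl))).mono le_rfl
      (F' := Set.range fun (p : Fin a × Fin d) x => ∑ j, x (.inl (p.1, j)) * x (.inr (j, p.2)))
      (by rintro _ ⟨p, rfl⟩; exact ⟨p.1, p.2, by ext x; simp [Matrix.mul_apply]⟩) le_rfl
      |>.exists_circuit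
  exact ⟨Γ, fun A B => hΓ _, hs⟩

/-- The bracketing `(A Hᵀ)(H B)` with the unscaled sign matrix `H` takes three block products; the
two factors `1 / √c` are merged into one final scaling by `c⁻¹`. The other terms count the constants
`0` and `c⁻¹`, the `n * m` scalings and the `c * q` random signs. -/
lemma SketchedProductInTime.of_blocks {k : ℕ} {T : ℝ} (hk : 0 < k) (hT : ProductInTime k k k T)
    {n q m c n' q' m' c' : ℕ} (hn : n ≤ n' * k) (hq : q ≤ q' * k) (hm : m ≤ m' * k)
    (hc : c ≤ c' * k) :
    SketchedProductInTime n q m c (2 + (n' * c' * q' + c' * m' * q' + n' * m' * c') * (T + k ^ 2) +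
      n * m + c * q) := by
  let I := (Fin n × Fin q) ⊕ (Fin q × Fin m) ⊕ (Fin c × Fin q)
  let A : Matrix (Fin n) (Fin q) ((I → ℝ) → ℝ) := .of fun i j x => x (.inl (i, j))
  let B : Matrix (Fin q) (Fin m) ((I → ℝ) → ℝ) := .of fun i j x => x (.inr (.inl (i, j)))
  let H : Matrix (Fin c) (Fin q) ((I → ℝ) → ℝ) := .of fun i j x => x (.inr (.inr (i, j)))
  let F₀ : Set ((I → ℝ) → ℝ) := Set.range fun i x => x i
  let F : Set ((I → ℝ) → ℝ) := F₀ ∪ ({fun _ => 0} ∪ {fun _ => (c : ℝ)⁻¹})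
  have h₁ : ComputableFrom F (entrySet (A * H.transpose) ∪ entrySet (H * B)) _ :=
    (ComputableFrom.matrix_mul hk hT hn hq hc (fun i j => .inl ⟨_, rfl⟩)
      (fun i j => .inl ⟨_, rfl⟩) (.inr (.inl rfl))).union
    (ComputableFrom.matrix_mul hk hT hc hq hm (fun i j => .inl ⟨_, rfl⟩)
      (fun i j => .inl ⟨_, rfl⟩) (.inr (.inl rfl)))
  have h₂ : ComputableFrom F (entrySet ((A * H.transpose) * (H * B))) _ :=
    h₁.trans (ComputableFrom.matrix_mul hk hT hn hc hm
      (fun i j => .inr (.inl (entry_mem_entrySet _ _ _)))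
      (fun i j => .inr (.inr (entry_mem_entrySet _ _ _))) (.inl (.inr (.inl rfl))))
  have h₃ := h₂.trans (ComputableFrom.matrix (t := 1)
    (M := fun i j => ((A * H.transpose) * (H * B)) i j * fun _ => (c : ℝ)⁻¹) fun i j =>
      ComputableFrom.mul (.inr (entry_mem_entrySet _ _ _)) (.inl (.inr (.inr rfl))))
  have h₄ := ((ComputableFrom.const 0).union (ComputableFrom.const (c : ℝ)⁻¹)).trans h₃
  obtain ⟨Γ, hΓ, hs⟩ := (h₄.mono le_rfl (F' := Set.range fun (p : Fin n × Fin m) =>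
    ((A * H.transpose) * (H * B)) p.1 p.2 * fun _ => (c : ℝ)⁻¹)
    (by rintro _ ⟨p, rfl⟩; exact ⟨p.1, p.2, rfl⟩) le_rfl).exists_circuit
  refine ⟨Γ, fun A' B' h => ?_, ?_⟩
  · convert hΓ _ using 1
    ext p
    have hS : ∀ i j, sketch h i j = ((h i j : ℤ) : ℝ) / √(c : ℝ) := fun i j => rfl
    have hc : (c : ℝ)⁻¹ = (√(c : ℝ))⁻¹ * (√(c : ℝ))⁻¹ := by
      rw [← mul_inv, Real.mul_self_sqrt (Nat.cast_nonneg c)]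
    rw [entries, Matrix.mul_assoc]
    simp only [Matrix.mul_apply, Matrix.transpose_apply, Matrix.of_apply, hS, A, B, H, Pi.mul_apply,
      Finset.sum_apply, Sum.elim_inl, Sum.elim_inr, entries]
    rw [Finset.sum_mul]
    refine Finset.sum_congr rfl fun i _ => ?_
    rw [hc]
    simp only [Finset.sum_mul, Finset.mul_sum]
    refine Finset.sum_congr rfl fun j _ => Finset.sum_congr rfl fun l _ => ?_
    ring
  · simp only [Fintype.card_fin] at hs
    linarith

end Gates

end TugOfWar

namespace TugOfWar

open scoped BigOperators

/-! ### Averages over random signs -/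

section Signs

variable {q c : ℕ}

lemma expect_signs_succ (F : (Fin (q + 1) → ℤˣ) → ℝ) :
    𝔼 g, F g = ((𝔼 g, F (Fin.cons 1 g)) + 𝔼 g, F (Fin.cons (-1) g)) / 2 := by
  rw [← Fintype.expect_equiv (Fin.consEquiv fun _ => ℤˣ) (fun p => F (Fin.cons p.1 p.2)) F
    (fun p => rfl), ← Finset.univ_product_univ, Finset.expect_product,
    Fintype.expect_eq_sum_div_card]
  simp [UnitsInt.univ]

/-- The signed sum of a vector. -/
def signSum (g : Fin q → ℤˣ) (a : Fin q → ℝ) : ℝ := ∑ i, ((g i : ℤ) : ℝ) * a i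

lemma signSum_cons (s : ℤˣ) (g : Fin q → ℤˣ) (a : Fin (q + 1) → ℝ) :
    signSum (Fin.cons s g) a = ((s : ℤ) : ℝ) * a 0 + signSum g fun i => a i.succ := by
  simp [signSum, Fin.sum_univ_succ]

/-- The shifts `x`, `y` absorb the sign split off in the induction; terms linear in it cancel. -/
lemma expect_signSum_mul_signSum (a b : Fin q → ℝ) (x y : ℝ) :
    𝔼 g, (x + signSum g a) * (y + signSum g b) = x * y + ∑ i, a i * b i := by
  induction q generalizing x y with
  | zero => simp [signSum]
  | succ q ih =>
    simp only [expect_signs_succ, signSum_cons, ← add_assoc]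
    rw [ih, ih, Fin.sum_univ_succ]
    push_cast
    ring

/-- With a Gaussian of variance `s = ∑ a i ^ 2` in place of the signed sum, the value is `(1 -
s/2)^(-1/2) exp (x² / (4 - 2s))`, and the first factor is at most `exp (s / (4 - 2s))`. This form is
preserved by adding one sign, whose average produces a `cosh`. -/
lemma expect_exp_signSum_sq_le (a : Fin q → ℝ) (x : ℝ) (ha : ∑ i, a i ^ 2 < 2) :
    𝔼 g, Real.exp ((x + signSum g a) ^ 2 / 4) ≤
      Real.exp ((∑ i, a i ^ 2 + x ^ 2) / (4 - 2 * ∑ i, a i ^ 2)) := by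
  induction q generalizing x with
  | zero => simp [signSum]
  | succ q ih =>
    simp only [expect_signs_succ, signSum_cons, ← add_assoc]
    rw [Fin.sum_univ_succ] at ha ⊢
    have hs : ∑ i : Fin q, a i.succ ^ 2 < 2 := by nlinarith [sq_nonneg (a 0)]
    have hs0 : 0 ≤ ∑ i : Fin q, a i.succ ^ 2 := Finset.sum_nonneg fun _ _ => sq_nonneg _
    have h₁ := ih (fun i => a i.succ) (x + a 0) hs
    have h₂ := ih (fun i => a i.succ) (x - a 0) hs
    simp only [Units.val_one, Int.cast_one, one_mul, Units.val_neg, Int.cast_neg, neg_mul,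
      ← sub_eq_add_neg]
    set s := ∑ i : Fin q, a i.succ ^ 2
    have hD : 0 < 4 - 2 * s := by linarith
    have hD' : 0 < 4 - 2 * (a 0 ^ 2 + s) := by linarith
    have hcosh := Real.cosh_le_exp_half_sq (2 * x * a 0 / (4 - 2 * s))
    rw [Real.cosh_eq] at hcosh
    have e₁ : Real.exp ((s + (x + a 0) ^ 2) / (4 - 2 * s)) =
        Real.exp ((s + x ^ 2 + a 0 ^ 2) / (4 - 2 * s)) * Real.exp (2 * x * a 0 / (4 - 2 * s)) := by
      rw [← Real.exp_add]
      ring_nf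
    have e₂ : Real.exp ((s + (x - a 0) ^ 2) / (4 - 2 * s)) =
        Real.exp ((s + x ^ 2 + a 0 ^ 2) / (4 - 2 * s)) *
          Real.exp (-(2 * x * a 0 / (4 - 2 * s))) := by
      rw [← Real.exp_add]
      ring_nf
    calc _ ≤ Real.exp ((s + x ^ 2 + a 0 ^ 2) / (4 - 2 * s)) *
          ((Real.exp (2 * x * a 0 / (4 - 2 * s)) + Real.exp (-(2 * x * a 0 / (4 - 2 * s)))) / 2) := by
            rw [e₁] at h₁
            rw [e₂] at h₂
            linarith
      _ ≤ Real.exp ((s + x ^ 2 + a 0 ^ 2) / (4 - 2 * s)) *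
          Real.exp ((2 * x * a 0 / (4 - 2 * s)) ^ 2 / 2) := by gcongr
      _ ≤ _ := by
            rw [← Real.exp_add]
            refine Real.exp_le_exp.2 ?_
            -- With `D = 4 - 2 * s` this reduces to `(D + 2 a₀²)(D - 2 a₀²) ≤ D²`.
            have hx : x ^ 2 / (4 - 2 * s) + (2 * x * a 0 / (4 - 2 * s)) ^ 2 / 2 ≤
                x ^ 2 / (4 - 2 * (a 0 ^ 2 + s)) := by
              have : x ^ 2 / (4 - 2 * s) + (2 * x * a 0 / (4 - 2 * s)) ^ 2 / 2 =
                  x ^ 2 * ((4 - 2 * s) + 2 * a 0 ^ 2) / (4 - 2 * s) ^ 2 := by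
                field_simp
              rw [this, div_le_div_iff₀ (by positivity) hD', mul_assoc]
              refine mul_le_mul_of_nonneg_left ?_ (sq_nonneg x)
              nlinarith [sq_nonneg (a 0 ^ 2)]
            have hsa : (s + a 0 ^ 2) / (4 - 2 * s) ≤ (a 0 ^ 2 + s) / (4 - 2 * (a 0 ^ 2 + s)) := by
              rw [add_comm s]
              gcongr
              exact le_add_of_nonneg_left (sq_nonneg _)
            rw [add_div (a 0 ^ 2 + s)]
            calc _ = (s + a 0 ^ 2) / (4 - 2 * s) +
                  (x ^ 2 / (4 - 2 * s) + (2 * x * a 0 / (4 - 2 * s)) ^ 2 / 2) := by ring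
              _ ≤ _ := add_le_add hsa hx

lemma expect_exp_signSum_sq_le_exp_half (a : Fin q → ℝ) (ha : ∑ i, a i ^ 2 ≤ 1) :
    𝔼 g, Real.exp (signSum g a ^ 2 / 4) ≤ Real.exp (1 / 2) := by
  have h := expect_exp_signSum_sq_le a 0 (by linarith)
  simp only [zero_add] at h
  refine h.trans (Real.exp_le_exp.2 ?_)
  rw [div_le_div_iff₀ (by linarith) (by norm_num)]
  linarith

/-! ### Exponential moments of the error -/

/-- The error of the estimate of the inner product of `a` and `b` from one random sign vector. -/
def signErr (a b : Fin q → ℝ) (g : Fin q → ℤˣ) : ℝ :=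
  signSum g a * signSum g b - ∑ i, a i * b i

lemma expect_signErr (a b : Fin q → ℝ) : 𝔼 g, signErr a b g = 0 := by
  have := expect_signSum_mul_signSum a b 0 0
  simp only [zero_add, mul_zero] at this
  simp [signErr, Finset.expect_sub_distrib, this]

lemma exp_le_one_add_add_sq_mul_exp_abs (u : ℝ) :
    Real.exp u ≤ 1 + u + u ^ 2 * Real.exp |u| := by
  have h := Complex.norm_exp_sub_sum_le_norm_mul_exp (u : ℂ) 2
  have e : Complex.exp u - ∑ m ∈ Finset.range 2, (u : ℂ) ^ m / m.factorial =
      ((Real.exp u - (1 + u) : ℝ) : ℂ) := by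
    simp [Finset.sum_range_succ]
  rw [e, Complex.norm_real, Complex.norm_real, Real.norm_eq_abs, Real.norm_eq_abs, sq_abs] at h
  linarith [le_abs_self (Real.exp u - (1 + u))]

lemma exp_three_quarters_le : 128 * Real.exp (3 / 4) ≤ 384 := by
  have h : Real.exp (3 / 4) ≤ Real.exp 1 := Real.exp_le_exp.2 (by norm_num)
  linarith [Real.exp_one_lt_d9]

lemma abs_signErr_le {a b : Fin q → ℝ} (ha : ∑ i, a i ^ 2 ≤ 1) (hb : ∑ i, b i ^ 2 ≤ 1)
    (g : Fin q → ℤˣ) :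
    |signErr a b g| ≤ (signSum g a ^ 2 + signSum g b ^ 2) / 2 + 1 := by
  have h₁ : |∑ i, a i * b i| ≤ 1 := by
    have h := Finset.sum_mul_sq_le_sq_mul_sq Finset.univ a b
    have h0 : 0 ≤ ∑ i, b i ^ 2 := Finset.sum_nonneg fun _ _ => sq_nonneg _
    rw [← sq_le_one_iff_abs_le_one]
    nlinarith
  have h₂ : |signSum g a * signSum g b| ≤ (signSum g a ^ 2 + signSum g b ^ 2) / 2 := by
    rw [abs_le]
    constructor <;> nlinarith [sq_nonneg (signSum g a + signSum g b),
      sq_nonneg (signSum g a - signSum g b)]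
  exact (abs_sub _ _).trans (add_le_add h₂ h₁)

/-- The error is at most `W + 1`. Half of the exponent `(W + 1) / 4` dominates the square, by `y² /
2 ≤ exp y` at `y = (W + 1) / 8` (hence 128), and the other half dominates the exponential. Finally
`exp (W / 4)` is a geometric mean, bounded by the arithmetic mean. -/
lemma sq_mul_exp_abs_signErr_le {a b : Fin q → ℝ} (ha : ∑ i, a i ^ 2 ≤ 1)
    (hb : ∑ i, b i ^ 2 ≤ 1) {l : ℝ} (hl : |l| ≤ 1 / 8) (g : Fin q → ℤˣ) :
    (l * signErr a b g) ^ 2 * Real.exp |l * signErr a b g| ≤ 128 * Real.exp (1 / 4) * l ^ 2 *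
      ((Real.exp (signSum g a ^ 2 / 4) + Real.exp (signSum g b ^ 2 / 4)) / 2) := by
  have h := abs_signErr_le ha hb g
  set z := signErr a b g
  set W := (signSum g a ^ 2 + signSum g b ^ 2) / 2 with hW
  have h₁ : z ^ 2 ≤ 128 * Real.exp ((W + 1) / 8) := by
    have h' := Real.pow_div_factorial_le_exp ((W + 1) / 8) (by linarith [abs_nonneg z]) 2
    have : z ^ 2 ≤ (W + 1) ^ 2 := sq_le_sq' (by linarith [neg_abs_le z]) (by linarith [le_abs_self z])
    norm_num [Nat.factorial] at h'
    linarith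
  have h₂ : Real.exp |l * z| ≤ Real.exp ((W + 1) / 8) := by
    refine Real.exp_le_exp.2 ?_
    rw [abs_mul]
    nlinarith [abs_nonneg z, abs_nonneg l]
  have h₃ : Real.exp (W / 4) ≤
      (Real.exp (signSum g a ^ 2 / 4) + Real.exp (signSum g b ^ 2 / 4)) / 2 := by
    have e₁ : Real.exp (signSum g a ^ 2 / 4) = Real.exp (signSum g a ^ 2 / 8) ^ 2 := by
      rw [← Real.exp_nat_mul]
      push_cast
      ring_nf
    have e₂ : Real.exp (signSum g b ^ 2 / 4) = Real.exp (signSum g b ^ 2 / 8) ^ 2 := by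
      rw [← Real.exp_nat_mul]
      push_cast
      ring_nf
    have e₃ : Real.exp (W / 4) = Real.exp (signSum g a ^ 2 / 8) * Real.exp (signSum g b ^ 2 / 8) := by
      rw [← Real.exp_add, hW]
      ring_nf
    rw [e₁, e₂, e₃]
    nlinarith [sq_nonneg (Real.exp (signSum g a ^ 2 / 8) - Real.exp (signSum g b ^ 2 / 8))]
  calc (l * z) ^ 2 * Real.exp |l * z|
      ≤ l ^ 2 * (128 * Real.exp ((W + 1) / 8)) * Real.exp ((W + 1) / 8) := by
        rw [mul_pow]
        gcongr
    _ = 128 * Real.exp (1 / 4) * l ^ 2 * Real.exp (W / 4) := by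
        have : Real.exp (1 / 4) * Real.exp (W / 4) =
            Real.exp ((W + 1) / 8) * Real.exp ((W + 1) / 8) := by
          rw [← Real.exp_add, ← Real.exp_add]
          ring_nf
        linear_combination (-128 * l ^ 2) * this
    _ ≤ _ := by gcongr

/-- The linear term of the expansion averages to zero, which leaves a bound quadratic in `l`. -/
lemma expect_exp_signErr_le {a b : Fin q → ℝ} (ha : ∑ i, a i ^ 2 ≤ 1) (hb : ∑ i, b i ^ 2 ≤ 1)
    {l : ℝ} (hl : |l| ≤ 1 / 8) :
    𝔼 g, Real.exp (l * signErr a b g) ≤ Real.exp (384 * l ^ 2) := by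
  calc 𝔼 g, Real.exp (l * signErr a b g)
      ≤ 𝔼 g, (1 + l * signErr a b g + 128 * Real.exp (1 / 4) * l ^ 2 *
        ((Real.exp (signSum g a ^ 2 / 4) + Real.exp (signSum g b ^ 2 / 4)) / 2)) := by
        refine Finset.expect_le_expect fun g _ => ?_
        linarith [exp_le_one_add_add_sq_mul_exp_abs (l * signErr a b g),
          sq_mul_exp_abs_signErr_le ha hb hl g]
    _ = 1 + 128 * Real.exp (1 / 4) * l ^ 2 * (((𝔼 g, Real.exp (signSum g a ^ 2 / 4)) +
        𝔼 g, Real.exp (signSum g b ^ 2 / 4)) / 2) := by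
        rw [Finset.expect_add_distrib, Finset.expect_add_distrib, ← Finset.mul_expect,
          expect_signErr, ← Finset.mul_expect, ← Finset.expect_div, Finset.expect_add_distrib,
          Fintype.expect_const]
        ring
    _ ≤ 1 + 128 * Real.exp (1 / 4) * l ^ 2 * ((Real.exp (1 / 2) + Real.exp (1 / 2)) / 2) := by
        gcongr
        exacts [expect_exp_signSum_sq_le_exp_half a ha, expect_exp_signSum_sq_le_exp_half b hb]
    _ = 1 + 128 * Real.exp (3 / 4) * l ^ 2 := by
        have : Real.exp (3 / 4) = Real.exp (1 / 4) * Real.exp (1 / 2) := by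
          rw [← Real.exp_add]
          norm_num
        rw [this]
        ring
    _ ≤ 384 * l ^ 2 + 1 := by nlinarith [exp_three_quarters_le, sq_nonneg l]
    _ ≤ _ := Real.add_one_le_exp _

/-- The sum of the errors of `c` independent estimates. -/
def signErrSum (a b : Fin q → ℝ) (h : Fin c → Fin q → ℤˣ) : ℝ := ∑ k, signErr a b (h k)

lemma expect_exp_signErrSum_le {a b : Fin q → ℝ} (ha : ∑ i, a i ^ 2 ≤ 1) (hb : ∑ i, b i ^ 2 ≤ 1)
    {l : ℝ} (hl : |l| ≤ 1 / 8) :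
    𝔼 h : Fin c → Fin q → ℤˣ, Real.exp (l * signErrSum a b h) ≤ Real.exp (384 * l ^ 2 * c) := by
  have h₁ := Finset.expect_pow Finset.univ (fun g => Real.exp (l * signErr a b g)) c
  rw [Fintype.piFinset_univ] at h₁
  simp only [signErrSum, Finset.mul_sum, Real.exp_sum]
  rw [← h₁, mul_comm _ (c : ℝ), Real.exp_nat_mul]
  exact pow_le_pow_left₀ (Finset.expect_nonneg fun _ _ => (Real.exp_pos _).le)
    (expect_exp_signErr_le ha hb hl) c

/-! ### Power moments of the error -/

lemma exp_six_le : 256 * Real.exp 6 ≤ 103500 := by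
  have h : Real.exp 6 = Real.exp 1 ^ 6 := by
    rw [← Real.exp_nat_mul]
    norm_num
  have h' : Real.exp 1 ^ 6 ≤ 2.7182818286 ^ 6 :=
    pow_le_pow_left₀ (Real.exp_pos 1).le Real.exp_one_lt_d9.le 6
  rw [h]
  norm_num at h' ⊢
  linarith

lemma expect_signErrSum_pow_le_of_le_one {a b : Fin q → ℝ} (ha : ∑ i, a i ^ 2 ≤ 1)
    (hb : ∑ i, b i ^ 2 ≤ 1) {p : ℕ} (hp : 0 < p) (hpc : p ≤ c) :
    𝔼 h : Fin c → Fin q → ℤˣ, (signErrSum a b h ^ 2) ^ p ≤ 2 * (103500 * p * c) ^ p := by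
  have hp' : (0 : ℝ) < p := by exact_mod_cast hp
  have hc' : (0 : ℝ) < c := by exact_mod_cast hp.trans_le hpc
  have hpc' : (p : ℝ) ≤ c := by exact_mod_cast hpc
  -- The largest scale with `384 * l ^ 2 * c` of order `p` that `p ≤ c` keeps within `|l| ≤ 1 / 8`;
  -- the exponent becomes exactly `6 * p`.
  set l : ℝ := √(p / c) / 8 with hl
  have hl2 : l ^ 2 = p / (64 * c) := by
    rw [hl, div_pow, Real.sq_sqrt (by positivity)]
    field_simp
    norm_num
  have hl8 : |l| ≤ 1 / 8 := by
    rw [abs_of_nonneg (by positivity), hl]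
    gcongr
    exact Real.sqrt_le_one.2 ((div_le_one hc').2 hpc')
  have h₁ : ∀ D : ℝ, (l ^ 2) ^ p * (D ^ 2) ^ p ≤
      ((2 * p).factorial : ℝ) * (Real.exp (l * D) + Real.exp (-l * D)) := by
    intro D
    have h := Real.pow_div_factorial_le_exp |l * D| (abs_nonneg _) (2 * p)
    rw [div_le_iff₀ (by positivity), pow_mul, sq_abs, mul_pow, mul_pow] at h
    refine h.trans ?_
    rw [mul_comm]
    gcongr
    rw [neg_mul]
    rcases abs_cases (l * D) with ⟨e, -⟩ | ⟨e, -⟩ <;> rw [e] <;>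
      linarith [Real.exp_pos (l * D), Real.exp_pos (-(l * D))]
  have h₂ : (l ^ 2) ^ p * 𝔼 h : Fin c → Fin q → ℤˣ, (signErrSum a b h ^ 2) ^ p ≤
      ((2 * p).factorial : ℝ) * (2 * Real.exp (6 * p)) := by
    rw [Finset.mul_expect]
    refine (Finset.expect_le_expect fun h _ => h₁ _).trans ?_
    rw [← Finset.mul_expect, Finset.expect_add_distrib]
    have e₁ := expect_exp_signErrSum_le (c := c) ha hb hl8
    have e₂ := expect_exp_signErrSum_le (c := c) ha hb (l := -l) (by rwa [abs_neg])
    have e : 384 * l ^ 2 * c = 6 * p := by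
      rw [hl2]
      field_simp
      norm_num
    rw [neg_sq, e] at e₂
    rw [e] at e₁
    gcongr
    linarith
  have h₃ : ((2 * p).factorial : ℝ) ≤ (4 * (p : ℝ) ^ 2) ^ p := by
    have : ((2 * p).factorial : ℝ) ≤ ((2 * p : ℕ) : ℝ) ^ (2 * p) := by
      exact_mod_cast Nat.factorial_le_pow (2 * p)
    refine this.trans (le_of_eq ?_)
    rw [pow_mul]
    push_cast
    ring
  have h₄ : Real.exp (6 * p) = Real.exp 6 ^ p := by rw [mul_comm, Real.exp_nat_mul]
  rw [← mul_le_mul_iff_right₀ (show 0 < (l ^ 2) ^ p by rw [hl2]; positivity)]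
  refine h₂.trans ?_
  calc _ ≤ (4 * (p : ℝ) ^ 2) ^ p * (2 * Real.exp 6 ^ p) := by rw [h₄]; gcongr
    _ = 2 * ((p : ℝ) ^ 2 / 64 * (256 * Real.exp 6)) ^ p := by
        rw [mul_left_comm, ← mul_pow]
        ring_nf
    _ ≤ 2 * ((p : ℝ) ^ 2 / 64 * 103500) ^ p := by
        gcongr
        exact exp_six_le
    _ = _ := by
        rw [mul_left_comm, ← mul_pow, hl2]
        congr 2
        field_simp

lemma signErr_smul (r s : ℝ) (a b : Fin q → ℝ) (g : Fin q → ℤˣ) :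
    signErr (r • a) (s • b) g = r * s * signErr a b g := by
  have e : ∀ (r : ℝ) (a : Fin q → ℝ), signSum g (r • a) = r * signSum g a := fun r a => by
    simp only [signSum, Pi.smul_apply, smul_eq_mul, Finset.mul_sum]
    exact Finset.sum_congr rfl fun _ _ => by ring
  have e' : ∑ i, (r • a) i * (s • b) i = r * s * ∑ i, a i * b i := by
    simp only [Pi.smul_apply, smul_eq_mul, Finset.mul_sum]
    exact Finset.sum_congr rfl fun _ _ => by ring
  rw [signErr, signErr, e, e, e']
  ring

lemma exists_smul_sum_sq_le_one (a : Fin q → ℝ) :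
    ∃ a' : Fin q → ℝ, ∑ i, a' i ^ 2 ≤ 1 ∧ a = √(∑ i, a i ^ 2) • a' := by
  set s := ∑ i, a i ^ 2 with hs
  have hs0 : 0 ≤ s := Finset.sum_nonneg fun _ _ => sq_nonneg _
  rcases hs0.eq_or_lt with h | h
  -- The zero vector has no normalisation, which is why the norm is only required to be at most 1.
  · refine ⟨0, by simp, ?_⟩
    have := (Finset.sum_eq_zero_iff_of_nonneg fun i _ => sq_nonneg (a i)).1 (hs ▸ h.symm)
    ext i
    simpa using this i (Finset.mem_univ i)
  · have h' : √s ≠ 0 := (Real.sqrt_pos.2 h).ne'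
    refine ⟨(√s)⁻¹ • a, ?_, by rw [smul_inv_smul₀ h']⟩
    simp only [Pi.smul_apply, smul_eq_mul, mul_pow, inv_pow, Real.sq_sqrt hs0, ← Finset.mul_sum]
    rw [← hs, inv_mul_cancel₀ h.ne']

/-- Moments of the error of the estimate of an inner product. -/
lemma expect_signErrSum_pow_le (a b : Fin q → ℝ) {p : ℕ} (hp : 0 < p) (hpc : p ≤ c) :
    𝔼 h : Fin c → Fin q → ℤˣ, (signErrSum a b h ^ 2) ^ p ≤
      2 * (103500 * p * c) ^ p * ((∑ i, a i ^ 2) * ∑ i, b i ^ 2) ^ p := by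
  obtain ⟨a', ha', ea⟩ := exists_smul_sum_sq_le_one a
  obtain ⟨b', hb', eb⟩ := exists_smul_sum_sq_le_one b
  have hs : 0 ≤ ∑ i, a i ^ 2 := Finset.sum_nonneg fun _ _ => sq_nonneg _
  have ht : 0 ≤ ∑ i, b i ^ 2 := Finset.sum_nonneg fun _ _ => sq_nonneg _
  set s := ∑ i, a i ^ 2
  set t := ∑ i, b i ^ 2
  have e : ∀ h : Fin c → Fin q → ℤˣ,
      (signErrSum a b h ^ 2) ^ p = (signErrSum a' b' h ^ 2) ^ p * (s * t) ^ p := fun h => by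
    have : signErrSum a b h = √s * √t * signErrSum a' b' h := by
      rw [ea, eb]
      simp only [signErrSum, signErr_smul, Finset.mul_sum]
    rw [this, ← mul_pow, mul_pow (√s * √t), mul_pow √s, Real.sq_sqrt hs, Real.sq_sqrt ht,
      mul_comm (s * t)]
  simp only [e]
  rw [← Finset.expect_mul]
  gcongr
  exact expect_signErrSum_pow_le_of_le_one ha' hb' hp hpc

/-- Minkowski's inequality for the average of the `p`-th power of a sum. -/
lemma expect_sum_pow_le {Ω α : Type*} [Fintype Ω] [Fintype α] {y : α → Ω → ℝ}
    (hy : ∀ i ω, 0 ≤ y i ω) {v : α → ℝ} (hv : ∀ i, 0 ≤ v i) {K : ℝ} {p : ℕ} (hp : 0 < p)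
    (h : ∀ i, 𝔼 ω, y i ω ^ p ≤ K * v i ^ p) :
    𝔼 ω, (∑ i, y i ω) ^ p ≤ K * (∑ i, v i) ^ p := by
  -- Makes the convention `V / 0 = 0` harmless below.
  have h0 : ∀ i, v i = 0 → ∀ ω, y i ω = 0 := fun i hi ω => by
    have h₁ := h i
    rw [hi, zero_pow hp.ne', mul_zero] at h₁
    have h₂ := (Finset.expect_eq_zero_iff_of_nonneg fun ω _ => pow_nonneg (hy i ω) p).1
      (h₁.antisymm (Finset.expect_nonneg fun ω _ => pow_nonneg (hy i ω) p)) ω (Finset.mem_univ ω)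
    exact pow_eq_zero_iff hp.ne' |>.1 h₂
  rcases (Finset.sum_nonneg fun i _ => hv i : 0 ≤ ∑ i, v i).eq_or_lt with hV | hV
  · have hv0 := (Finset.sum_eq_zero_iff_of_nonneg fun i _ => hv i).1 hV.symm
    rw [← hV, zero_pow hp.ne', mul_zero]
    refine (Finset.expect_eq_zero fun ω _ => ?_).le
    rw [Finset.sum_eq_zero fun i hi => h0 i (hv0 i hi) ω, zero_pow hp.ne']
  · set V := ∑ i, v i
    -- Convexity of the `p`-th power with weights `v i / V`, chosen so that all rescaled terms have
    -- the same moment bound `K * V ^ p`.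
    have hle : ∀ ω, (∑ i, y i ω) ^ p ≤ ∑ i, v i / V * (V / v i * y i ω) ^ p := fun ω => by
      have := Real.pow_arith_mean_le_arith_mean_pow Finset.univ (fun i => v i / V)
        (fun i => V / v i * y i ω) (fun i _ => div_nonneg (hv i) hV.le)
        (by rw [← Finset.sum_div]; exact div_self hV.ne')
        (fun i _ => mul_nonneg (div_nonneg hV.le (hv i)) (hy i ω)) p
      refine le_trans (le_of_eq ?_) this
      congr 1
      refine Finset.sum_congr rfl fun i _ => ?_
      rcases (hv i).eq_or_lt with hi | hi
      · rw [h0 i hi.symm ω]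
        simp
      · field_simp
    calc _ ≤ 𝔼 ω, ∑ i, v i / V * (V / v i * y i ω) ^ p := Finset.expect_le_expect fun ω _ => hle ω
      _ = ∑ i, v i / V * ((V / v i) ^ p * 𝔼 ω, y i ω ^ p) := by
          rw [Finset.expect_sum_comm]
          simp only [mul_pow, Finset.mul_expect]
      _ ≤ ∑ i, v i / V * (K * V ^ p) := by
          refine Finset.sum_le_sum fun i _ => ?_
          rcases (hv i).eq_or_lt with hi | hi
          · rw [← hi]
            simp
          · refine mul_le_mul_of_nonneg_left ?_ (div_nonneg (hv i) hV.le)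
            refine (mul_le_mul_of_nonneg_left (h i) (by positivity)).trans (le_of_eq ?_)
            rw [div_pow]
            field_simp
      _ = _ := by rw [← Finset.sum_mul, ← Finset.sum_div, div_self hV.ne', one_mul]

/-- Markov's inequality. -/
lemma le_signProb {E : Set (Fin c → Fin q → ℤˣ)} {δ : ℝ} {f : (Fin c → Fin q → ℤˣ) → ℝ}
    (hf : ∀ h, 0 ≤ f h) (hE : ∀ h, h ∉ E → 1 ≤ f h) (hδ : 𝔼 h, f h ≤ δ) :
    ENNReal.ofReal (1 - δ) ≤ signProb c q E := by
  classical
  have hN : (0 : ℝ) < Fintype.card (Fin c → Fin q → ℤˣ) := by exact_mod_cast Fintype.card_pos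
  rw [signProb, PMF.toOuterMeasure_uniformOfFintype_apply]
  have h₁ : (1 - δ) ≤ (Fintype.card E : ℝ) / Fintype.card (Fin c → Fin q → ℤˣ) := by
    have h₂ : 𝔼 h, (1 - f h) ≤ 𝔼 h, E.indicator 1 h := by
      refine Finset.expect_le_expect fun h _ => ?_
      by_cases hh : h ∈ E
      · simp [hh, hf]
      · simp [hh, hE]
    rw [Finset.expect_sub_distrib, Fintype.expect_const,
      Fintype.expect_eq_sum_div_card (E.indicator (1 : (Fin c → Fin q → ℤˣ) → ℝ))] at h₂
    have h₃ : ∑ h, E.indicator (1 : (Fin c → Fin q → ℤˣ) → ℝ) h = Fintype.card E := by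
      simp [Set.indicator_apply, Fintype.card_subtype]
    rw [h₃] at h₂
    linarith
  refine (ENNReal.ofReal_le_ofReal h₁).trans (le_of_eq ?_)
  rw [ENNReal.ofReal_div_of_pos hN, ENNReal.ofReal_natCast, ENNReal.ofReal_natCast]

end Signs

end TugOfWar

namespace TugOfWar

open scoped BigOperators

/-! ### Norms -/

section Norms

variable {n m : ℕ}

lemma frobNorm_sq (M : Matrix (Fin n) (Fin m) ℝ) : frobNorm M ^ 2 = ∑ i, ∑ j, M i j ^ 2 := by
  simp [frobNorm, entryNorm, EuclideanSpace.norm_sq_eq]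

lemma sum_row_sq_le_entryNorm_sq (M : Matrix (Fin n) (Fin m) ℝ) (i : Fin n) :
    ∑ j, M i j ^ 2 ≤ entryNorm 2 ⊤ M ^ 2 := by
  have h := PiLp.norm_apply_le (p := ⊤) (WithLp.toLp ⊤
    (fun i => ‖(WithLp.toLp 2 (M i) : PiLp 2 (fun _ : Fin m => ℝ))‖) :
      PiLp ⊤ (fun _ : Fin n => ℝ)) i
  have := pow_le_pow_left₀ (norm_nonneg _) h 2
  simpa [entryNorm, EuclideanSpace.norm_sq_eq] using this

lemma maxNorm_le {M : Matrix (Fin n) (Fin m) ℝ} {ε : ℝ} (hε : 0 ≤ ε) (h : ∀ i j, |M i j| ≤ ε) :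
    maxNorm M ≤ ε := by
  unfold maxNorm entryNorm
  rw [PiLp.norm_toLp, pi_norm_le_iff_of_nonneg hε]
  intro i
  rw [norm_norm, PiLp.norm_toLp, pi_norm_le_iff_of_nonneg hε]
  exact h i

end Norms

/-! ### Success probability -/

section Probability

variable {n q m c : ℕ}

lemma sketch_error_apply (hc : 0 < c) (A : Matrix (Fin n) (Fin q) ℝ)
    (B : Matrix (Fin q) (Fin m) ℝ) (h : Fin c → Fin q → ℤˣ) (i : Fin n) (j : Fin m) :
    (A * (sketch h).transpose * sketch h * B - A * B) i j =
      signErrSum (A i) (fun l => B l j) h / c := by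
  have hc' : (c : ℝ) ≠ 0 := by exact_mod_cast hc.ne'
  have hS : ∀ i j, sketch h i j = ((h i j : ℤ) : ℝ) / √(c : ℝ) := fun i j => rfl
  have h₁ : ∀ k, (A * (sketch h).transpose) i k = signSum (h k) (A i) / √(c : ℝ) := fun k => by
    simp only [Matrix.mul_apply, Matrix.transpose_apply, hS, signSum, Finset.sum_div]
    exact Finset.sum_congr rfl fun _ _ => by ring
  have h₂ : ∀ k, (sketch h * B) k j = signSum (h k) (fun l => B l j) / √(c : ℝ) := fun k => by
    simp only [Matrix.mul_apply, hS, signSum, Finset.sum_div]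
    exact Finset.sum_congr rfl fun _ _ => by ring
  rw [Matrix.sub_apply, Matrix.mul_assoc, Matrix.mul_apply]
  simp only [h₁, h₂, div_mul_div_comm, Real.mul_self_sqrt (Nat.cast_nonneg c)]
  simp only [signErrSum, signErr, Finset.sum_sub_distrib, Finset.sum_const, Finset.card_univ,
    Fintype.card_fin, nsmul_eq_mul, sub_div, Matrix.mul_apply, mul_div_cancel_left₀ _ hc',
    Finset.sum_div]

lemma expect_sketch_error_pow_le (A : Matrix (Fin n) (Fin q) ℝ) (B : Matrix (Fin q) (Fin m) ℝ)
    {p : ℕ} (hp : 0 < p) (hpc : p ≤ c) (i : Fin n) (j : Fin m) :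
    𝔼 h : Fin c → Fin q → ℤˣ, ((A * (sketch h).transpose * sketch h * B - A * B) i j ^ 2) ^ p ≤
      2 * (103500 * p / c) ^ p * ((∑ l, A i l ^ 2) * ∑ l, B l j ^ 2) ^ p := by
  have hc : 0 < c := hp.trans_le hpc
  have hc' : (0 : ℝ) < c := by exact_mod_cast hc
  simp only [sketch_error_apply hc, div_pow, ← Finset.expect_div]
  rw [div_le_iff₀ (by positivity)]
  refine (expect_signErrSum_pow_le _ _ hp hpc).trans (le_of_eq ?_)
  rw [mul_pow (103500 * (p : ℝ))]
  field_simp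
  ring

/-- The constant `10 ^ 6` is chosen here: `⌈L⌉ ≤ 2.5 L` and `103500 · 2.5 · e < 10 ^ 6`, so the base
of the moment bound is at most `1 / e`. -/
lemma sketch_size_bounds {X L : ℝ} (hX : 1 ≤ X) (hL : 2 / 3 ≤ L) :
    0 < ⌈L⌉₊ ∧ ⌈L⌉₊ ≤ ⌈10 ^ 6 * X * L⌉₊ ∧
      2 * (103500 * (⌈L⌉₊ : ℝ) / (⌈10 ^ 6 * X * L⌉₊ : ℝ)) ^ ⌈L⌉₊ * X ^ ⌈L⌉₊ ≤
        2 * Real.exp (-L) := by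
  have hXL : L ≤ X * L := le_mul_of_one_le_left (by linarith) hX
  have hp : 0 < ⌈L⌉₊ := Nat.ceil_pos.2 (by linarith)
  refine ⟨hp, Nat.ceil_mono (by linarith), ?_⟩
  have hpL : (⌈L⌉₊ : ℝ) ≤ 2.5 * L := by linarith [Nat.ceil_lt_add_one (show 0 ≤ L by linarith)]
  have hc := Nat.le_ceil (10 ^ 6 * X * L)
  have hLp := Nat.le_ceil L
  have hc0 : (0 : ℝ) < ⌈10 ^ 6 * X * L⌉₊ := lt_of_lt_of_le (by positivity) hc
  rw [mul_assoc, ← mul_pow]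
  calc 2 * (103500 * (⌈L⌉₊ : ℝ) / (⌈10 ^ 6 * X * L⌉₊ : ℝ) * X) ^ ⌈L⌉₊
      ≤ 2 * Real.exp (-1) ^ ⌈L⌉₊ := by
        gcongr
        rw [Real.exp_neg, div_mul_eq_mul_div, div_le_iff₀ hc0, inv_mul_eq_div,
          le_div_iff₀ (Real.exp_pos 1)]
        calc 103500 * (⌈L⌉₊ : ℝ) * X * Real.exp 1 ≤ 103500 * (2.5 * L) * X * 2.7182818286 := by
              gcongr
              exact Real.exp_one_lt_d9.le
          _ ≤ 10 ^ 6 * X * L := by nlinarith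
          _ ≤ _ := hc
    _ = 2 * Real.exp (-⌈L⌉₊) := by
        rw [← Real.exp_nat_mul]
        ring_nf
    _ ≤ _ := by gcongr

lemma le_signProb_maxNorm (A : Matrix (Fin n) (Fin q) ℝ) (B : Matrix (Fin q) (Fin m) ℝ)
    {ε δ X L : ℝ} (hε : 0 < ε) (hX : 1 ≤ X) (hL : 2 / 3 ≤ L)
    (hX' : entryNorm 2 ⊤ A ^ 2 * entryNorm 2 ⊤ B.transpose ^ 2 / ε ^ 2 ≤ X)
    (hδ : n * m * (2 * Real.exp (-L)) ≤ δ) :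
    ENNReal.ofReal (1 - δ) ≤ signProb ⌈10 ^ 6 * X * L⌉₊ q
      {h | maxNorm (A * (sketch h).transpose * sketch h * B - A * B) ≤ ε} := by
  obtain ⟨hp, hpc, hb⟩ := sketch_size_bounds hX hL
  set c := ⌈10 ^ 6 * X * L⌉₊
  set p := ⌈L⌉₊
  let M : (Fin c → Fin q → ℤˣ) → Matrix (Fin n) (Fin m) ℝ := fun h =>
    A * (sketch h).transpose * sketch h * B - A * B
  refine le_signProb (f := fun h => ∑ i, ∑ j, (M h i j ^ 2) ^ p / (ε ^ 2) ^ p)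
    (fun h => Finset.sum_nonneg fun _ _ => Finset.sum_nonneg fun _ _ => by positivity) ?_ ?_
  · intro h hh
    have hh' : ∃ i j, ε < |M h i j| := by
      by_contra! hcon
      exact hh (maxNorm_le hε.le hcon)
    obtain ⟨i, j, hij⟩ := hh'
    have h₁ : 1 ≤ (M h i j ^ 2) ^ p / (ε ^ 2) ^ p := by
      have h₂ : ε ^ 2 ≤ M h i j ^ 2 := by
        rw [← sq_abs (M h i j)]
        gcongr
      rw [one_le_div (by positivity)]
      gcongr
    exact h₁.trans ((Finset.single_le_sum (f := fun j => (M h i j ^ 2) ^ p / (ε ^ 2) ^ p)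
      (fun _ _ => by positivity) (Finset.mem_univ j)).trans (Finset.single_le_sum
        (f := fun i => ∑ j, (M h i j ^ 2) ^ p / (ε ^ 2) ^ p)
        (fun _ _ => Finset.sum_nonneg fun _ _ => by positivity) (Finset.mem_univ i)))
  · have h₁ : ∀ i j, 𝔼 h, (M h i j ^ 2) ^ p / (ε ^ 2) ^ p ≤ 2 * Real.exp (-L) := by
      intro i j
      rw [← Finset.expect_div, div_le_iff₀ (by positivity)]
      refine (expect_sketch_error_pow_le A B hp hpc i j).trans ?_
      have h₂ : (∑ l, A i l ^ 2) * ∑ l, B l j ^ 2 ≤ X * ε ^ 2 := by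
        rw [div_le_iff₀ (by positivity)] at hX'
        refine le_trans ?_ hX'
        gcongr
        exacts [sum_row_sq_le_entryNorm_sq A i, sum_row_sq_le_entryNorm_sq B.transpose j]
      calc _ ≤ 2 * (103500 * (p : ℝ) / c) ^ p * (X * ε ^ 2) ^ p := by
            gcongr
        _ = 2 * (103500 * (p : ℝ) / c) ^ p * X ^ p * (ε ^ 2) ^ p := by rw [mul_pow X]; ring
        _ ≤ _ := by gcongr
    refine le_trans ?_ hδ
    rw [Finset.expect_sum_comm]
    simp only [Finset.expect_sum_comm (Finset.univ : Finset (Fin _ → Fin q → ℤˣ))]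
    refine (Finset.sum_le_sum fun i _ => Finset.sum_le_sum fun j _ => h₁ i j).trans (le_of_eq ?_)
    simp
    ring

/-- The weights `‖A i‖² ‖B j‖²` given to Minkowski's inequality sum to exactly `‖A‖_F² ‖B‖_F²`. -/
lemma le_signProb_frobNorm (A : Matrix (Fin n) (Fin q) ℝ) (B : Matrix (Fin q) (Fin m) ℝ)
    {ε δ X L : ℝ} (hε : 0 < ε) (hX : 1 ≤ X) (hL : 2 / 3 ≤ L)
    (hX' : frobNorm A ^ 2 * frobNorm B ^ 2 / ε ^ 2 ≤ X) (hδ : 2 * Real.exp (-L) ≤ δ) :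
    ENNReal.ofReal (1 - δ) ≤ signProb ⌈10 ^ 6 * X * L⌉₊ q
      {h | frobNorm (A * (sketch h).transpose * sketch h * B - A * B) ≤ ε} := by
  obtain ⟨hp, hpc, hb⟩ := sketch_size_bounds hX hL
  set c := ⌈10 ^ 6 * X * L⌉₊
  set p := ⌈L⌉₊
  let M : (Fin c → Fin q → ℤˣ) → Matrix (Fin n) (Fin m) ℝ := fun h =>
    A * (sketch h).transpose * sketch h * B - A * B
  have hM : ∀ h, frobNorm (M h) ^ 2 = ∑ x : Fin n × Fin m, M h x.1 x.2 ^ 2 := fun h => by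
    rw [frobNorm_sq, Fintype.sum_prod_type]
  refine le_signProb (f := fun h => (frobNorm (M h) ^ 2) ^ p / (ε ^ 2) ^ p)
    (fun h => by positivity) ?_ ?_
  · intro h hh
    have hh' : ε < frobNorm (M h) := not_le.1 hh
    rw [one_le_div (by positivity)]
    gcongr
  · rw [← Finset.expect_div, div_le_iff₀ (by positivity)]
    simp only [hM]
    have h₁ := expect_sum_pow_le (Ω := Fin c → Fin q → ℤˣ) (α := Fin n × Fin m)
      (y := fun x h => M h x.1 x.2 ^ 2) (fun _ _ => sq_nonneg _)
      (v := fun x => (∑ l, A x.1 l ^ 2) * ∑ l, B l x.2 ^ 2) (fun _ => by positivity) hp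
      (fun x => expect_sketch_error_pow_le A B hp hpc x.1 x.2)
    have h₂ : ∑ x : Fin n × Fin m, (∑ l, A x.1 l ^ 2) * ∑ l, B l x.2 ^ 2 ≤ X * ε ^ 2 := by
      rw [div_le_iff₀ (by positivity), frobNorm_sq, frobNorm_sq, Finset.sum_comm (f := fun i j =>
        B i j ^ 2), Finset.sum_mul_sum, ← Fintype.sum_prod_type'] at hX'
      exact hX'
    refine h₁.trans ?_
    calc _ ≤ 2 * (103500 * (p : ℝ) / c) ^ p * (X * ε ^ 2) ^ p := by
          gcongr
      _ = 2 * (103500 * (p : ℝ) / c) ^ p * X ^ p * (ε ^ 2) ^ p := by rw [mul_pow X]; ring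
      _ ≤ _ := by
        gcongr
        exact hb.trans hδ

end Probability

/-! ### Running time -/

section Time

variable {n q m c : ℕ}

lemma ProductInTime.mono {S T : ℝ} (h : ProductInTime n q m S) (hST : S ≤ T) :
    ProductInTime n q m T := by
  obtain ⟨Γ, hΓ, hs⟩ := h
  exact ⟨Γ, hΓ, hs.trans hST⟩

lemma SketchedProductInTime.mono {S T : ℝ} (h : SketchedProductInTime n q m c S) (hST : S ≤ T) :
    SketchedProductInTime n q m c T := by
  obtain ⟨Γ, hΓ, hs⟩ := h
  exact ⟨Γ, hΓ, hs.trans hST⟩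

lemma IsMatMulExponent.exists_bound {ω : ℝ} (h : IsMatMulExponent ω) :
    ∃ K : ℝ, 0 ≤ K ∧ ∀ k : ℕ, ProductInTime k k k (K * (k : ℝ) ^ ω) := by
  obtain ⟨K, hK⟩ := h
  refine ⟨K, ?_, hK⟩
  obtain ⟨Γ, -, hs⟩ := hK 1
  rw [Nat.cast_one, Real.one_rpow, mul_one] at hs
  exact (Nat.cast_nonneg _).trans hs

lemma exists_block_count {k : ℕ} (hk : 0 < k) (hkn : k ≤ n) :
    ∃ n' : ℕ, n ≤ n' * k ∧ (n' : ℝ) * k ≤ 2 * n := by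
  refine ⟨n / k + 1, ?_, ?_⟩
  · rw [add_mul, one_mul, mul_comm]
    have := Nat.div_add_mod n k
    have := Nat.mod_lt n hk
    omega
  · have : (n / k + 1) * k ≤ 2 * n := by
      have := Nat.div_mul_le_self n k
      rw [add_mul]
      omega
    exact_mod_cast this

lemma block_cost_le {K ω : ℝ} (hω : 2 ≤ ω) {k : ℕ} (hk : 0 < k) :
    K * (k : ℝ) ^ ω + (k : ℝ) ^ 2 ≤ (K + 1) * ((k : ℝ) ^ 2 * (k : ℝ) ^ (ω - 2)) := by
  have hk' : (1 : ℝ) ≤ k := by exact_mod_cast hk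
  have h₁ : (k : ℝ) ^ ω = (k : ℝ) ^ 2 * (k : ℝ) ^ (ω - 2) := by
    rw [← Real.rpow_natCast, ← Real.rpow_add (by linarith)]
    norm_num
  have h₂ : (1 : ℝ) ≤ (k : ℝ) ^ (ω - 2) := Real.one_le_rpow hk' (by linarith)
  rw [h₁]
  nlinarith [sq_nonneg (k : ℝ)]

/-- Rectangular multiplication in blocks whose size is the smallest dimension. -/
lemma productInTime_min {K ω : ℝ} (hω : 2 ≤ ω) (hK : 0 ≤ K)
    (h : ∀ k : ℕ, ProductInTime k k k (K * (k : ℝ) ^ ω)) (hn : 0 < n) (hq : 0 < q) (hm : 0 < m) :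
    ProductInTime n q m
      ((8 * K + 9) * (m * n + n * q + q * m) * (min n (min q m) : ℕ) ^ (ω - 2)) := by
  obtain ⟨k, hk⟩ : ∃ k, k = min n (min q m) := ⟨_, rfl⟩
  rw [← hk]
  have hk0 : 0 < k := by omega
  have hkn : k ≤ n := by omega
  have hkq : k ≤ q := by omega
  have hkm : k ≤ m := by omega
  obtain ⟨n', hn', hn2⟩ := exists_block_count hk0 hkn
  obtain ⟨q', hq', hq2⟩ := exists_block_count hk0 hkq
  obtain ⟨m', hm', hm2⟩ := exists_block_count hk0 hkm
  refine (ProductInTime.of_blocks hk0 (h k) hn' hq' hm').mono ?_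
  have hk1 : (1 : ℝ) ≤ k := by exact_mod_cast hk0
  have hn1 : (1 : ℝ) ≤ n := by exact_mod_cast hn
  have hq1 : (1 : ℝ) ≤ q := by exact_mod_cast hq
  have hm1 : (1 : ℝ) ≤ m := by exact_mod_cast hm
  have hR : (1 : ℝ) ≤ (k : ℝ) ^ (ω - 2) := Real.one_le_rpow hk1 (by linarith)
  -- As `k` is one of the dimensions, `n * q * m` is `k` times one of the three areas.
  have hprod : (n : ℝ) * q * m ≤ (m * n + n * q + q * m) * k := by
    have h₁ : 0 ≤ (m : ℝ) * n * k := by positivity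
    have h₂ : 0 ≤ (n : ℝ) * q * k := by positivity
    have h₃ : 0 ≤ (q : ℝ) * m * k := by positivity
    have : k = n ∨ k = q ∨ k = m := by omega
    rcases this with e | e | e
    · have : (q : ℝ) * m * k = n * q * m := by rw [e]; ring
      linarith
    · have : (m : ℝ) * n * k = n * q * m := by rw [e]; ring
      linarith
    · have : (n : ℝ) * q * k = n * q * m := by rw [e]
      linarith
  set S : ℝ := m * n + n * q + q * m
  have hS : 1 ≤ S := by
    have : 1 ≤ m * n := Nat.mul_pos hm hn
    have : (1 : ℝ) ≤ m * n := by exact_mod_cast this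
    have : (0 : ℝ) ≤ n * q := by positivity
    have : (0 : ℝ) ≤ q * m := by positivity
    linarith
  have hblocks : (n' : ℝ) * m' * q' * (k : ℝ) ^ 2 ≤ 8 * S := by
    have : ((n' : ℝ) * m' * q' * (k : ℝ) ^ 2) * k ≤ 8 * S * k := by
      calc ((n' : ℝ) * m' * q' * (k : ℝ) ^ 2) * k = (n' * k) * (q' * k) * (m' * k) := by ring
        _ ≤ (2 * n) * (2 * q) * (2 * m) := by gcongr
        _ = 8 * (n * q * m) := by ring
        _ ≤ 8 * (S * k) := by gcongr
        _ = _ := by ring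
    exact le_of_mul_le_mul_right this (by linarith)
  calc 1 + (n' : ℝ) * m' * (q' * (K * (k : ℝ) ^ ω + (k : ℝ) ^ 2))
      ≤ 1 + (n' : ℝ) * m' * (q' * ((K + 1) * ((k : ℝ) ^ 2 * (k : ℝ) ^ (ω - 2)))) := by
        gcongr
        exact block_cost_le hω hk0
    _ = 1 + (n' * m' * q' * (k : ℝ) ^ 2) * (K + 1) * (k : ℝ) ^ (ω - 2) := by ring
    _ ≤ S * (k : ℝ) ^ (ω - 2) + (8 * S) * (K + 1) * (k : ℝ) ^ (ω - 2) := by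
        gcongr
        nlinarith
    _ = _ := by ring

lemma sketchedProductInTime_of_le_min {K ω : ℝ} (hω : 2 ≤ ω) (hK : 0 ≤ K)
    (h : ∀ k : ℕ, ProductInTime k k k (K * (k : ℝ) ^ ω)) (hc : 0 < c) (hcn : c ≤ min n (min q m)) :
    SketchedProductInTime n q m c
      ((8 * K + 9) * (m * n + n * q + q * m) * (c : ℝ) ^ (ω - 2)) := by
  have hn : c ≤ n := by omega
  have hq : c ≤ q := by omega
  have hm : c ≤ m := by omega
  obtain ⟨n', hn', hn2⟩ := exists_block_count hc hn
  obtain ⟨q', hq', hq2⟩ := exists_block_count hc hq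
  obtain ⟨m', hm', hm2⟩ := exists_block_count hc hm
  -- Blocks of size `c` make the sketch a single block in the direction of its rows.
  refine (SketchedProductInTime.of_blocks hc (h c) hn' hq' hm' (c' := 1) (by omega)).mono ?_
  have hc1 : (1 : ℝ) ≤ c := by exact_mod_cast hc
  have hcn : (c : ℝ) ≤ n := by exact_mod_cast hn
  have hm1 : (1 : ℝ) ≤ m := by exact_mod_cast hc.trans_le hm
  have hR : (1 : ℝ) ≤ (c : ℝ) ^ (ω - 2) := Real.one_le_rpow hc1 (by linarith)
  have hmn1 : (1 : ℝ) ≤ m * n := by nlinarith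
  have hnq0 : (0 : ℝ) ≤ n * q := by positivity
  have hqm0 : (0 : ℝ) ≤ q * m := by positivity
  have hcq : (c : ℝ) * q ≤ n * q := by gcongr
  have hS : 1 ≤ (m * n + n * q + q * m : ℝ) := by linarith
  have hblocks : ((n' : ℝ) * q' + m' * q' + n' * m') * (c : ℝ) ^ 2 ≤
      4 * (m * n + n * q + q * m) := by
    calc ((n' : ℝ) * q' + m' * q' + n' * m') * (c : ℝ) ^ 2 =
          (n' * c) * (q' * c) + (m' * c) * (q' * c) + (n' * c) * (m' * c) := by ring
      _ ≤ (2 * n) * (2 * q) + (2 * m) * (2 * q) + (2 * n) * (2 * m) := by gcongr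
      _ = _ := by ring
  have hadd : 2 + (n : ℝ) * m + c * q ≤ 3 * (m * n + n * q + q * m) * (c : ℝ) ^ (ω - 2) := by
    have : 3 * (m * n + n * q + q * m : ℝ) ≤ 3 * (m * n + n * q + q * m) * (c : ℝ) ^ (ω - 2) :=
      le_mul_of_one_le_right (by linarith) hR
    linarith [mul_comm (n : ℝ) m]
  set S : ℝ := m * n + n * q + q * m
  calc _ = (2 + (n : ℝ) * m + c * q) + ((n' : ℝ) * q' + m' * q' + n' * m') *
        (K * (c : ℝ) ^ ω + (c : ℝ) ^ 2) := by push_cast; ring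
    _ ≤ 3 * S * (c : ℝ) ^ (ω - 2) + ((n' : ℝ) * q' + m' * q' + n' * m') *
        ((K + 1) * ((c : ℝ) ^ 2 * (c : ℝ) ^ (ω - 2))) := by
        gcongr
        exact block_cost_le hω hc
    _ = 3 * S * (c : ℝ) ^ (ω - 2) + (((n' : ℝ) * q' + m' * q' + n' * m') * (c : ℝ) ^ 2) *
        (K + 1) * (c : ℝ) ^ (ω - 2) := by ring
    _ ≤ 3 * S * (c : ℝ) ^ (ω - 2) + 4 * S * (K + 1) * (c : ℝ) ^ (ω - 2) := by gcongr
    _ = (4 * K + 7) * S * (c : ℝ) ^ (ω - 2) := by ring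
    _ ≤ _ := by
        gcongr <;> linarith

lemma sketchedProductInTime_cubic {K : ℝ} (hK : 0 ≤ K) (h : ProductInTime 1 1 1 K)
    (hn : 0 < n) (hm : 0 < m) (hc : 0 < c) :
    SketchedProductInTime n q m c ((8 * K + 9) * (m * n + n * q + q * m) * c) := by
  refine (SketchedProductInTime.of_blocks one_pos h (mul_one n).ge (mul_one q).ge (mul_one m).ge
    (mul_one c).ge).mono ?_
  have hn1 : (1 : ℝ) ≤ n := by exact_mod_cast hn
  have hm1 : (1 : ℝ) ≤ m := by exact_mod_cast hm
  have hc1 : (1 : ℝ) ≤ c := by exact_mod_cast hc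
  have hmn1 : (1 : ℝ) ≤ m * n := by nlinarith
  have hnq0 : (0 : ℝ) ≤ n * q := by positivity
  have hqm0 : (0 : ℝ) ≤ q * m := by positivity
  have hcq : (c : ℝ) * q ≤ c * (n * q) :=
    mul_le_mul_of_nonneg_left (le_mul_of_one_le_left (Nat.cast_nonneg q) hn1) (by linarith)
  have hmn : (m * n : ℝ) ≤ c * (m * n) := le_mul_of_one_le_left (by linarith) hc1
  have hnq : (0 : ℝ) ≤ c * (n * q) := by positivity
  have hqm : (0 : ℝ) ≤ c * (q * m) := by positivity
  have hS : (0 : ℝ) ≤ K * (c * (m * n + n * q + q * m)) := by positivity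
  push_cast
  linarith

/-! ### From the sketch size to the time bound -/

lemma rpow_ceil_le {X L ω : ℝ} (hω : 2 ≤ ω) (hω' : ω ≤ 3) (hX : 1 ≤ X) (hL : 2 / 3 ≤ L) :
    (⌈10 ^ 6 * X * L⌉₊ : ℝ) ^ (ω - 2) ≤ 1000002 * (X * L) ^ (ω - 2) := by
  have hXL : L ≤ X * L := le_mul_of_one_le_left (by linarith) hX
  have h₁ : (⌈10 ^ 6 * X * L⌉₊ : ℝ) ≤ 1000002 * (X * L) := by
    have := Nat.ceil_lt_add_one (show 0 ≤ 10 ^ 6 * X * L by positivity)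
    linarith
  calc _ ≤ (1000002 * (X * L)) ^ (ω - 2) :=
        Real.rpow_le_rpow (Nat.cast_nonneg _) h₁ (by linarith)
    _ = (1000002 : ℝ) ^ (ω - 2) * (X * L) ^ (ω - 2) :=
        Real.mul_rpow (by norm_num) (by linarith)
    _ ≤ (1000002 : ℝ) ^ (1 : ℝ) * (X * L) ^ (ω - 2) := by
        refine mul_le_mul_of_nonneg_right ?_ (Real.rpow_nonneg (by linarith) _)
        exact Real.rpow_le_rpow_of_exponent_le (by norm_num) (by linarith)
    _ = _ := by rw [Real.rpow_one]

/-- The Frobenius time bound has `L` instead of `L ^ (ω - 2)`. Since `L` may be below 1, it is first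
scaled up by `3 / 2`. -/
lemma rpow_le_three_halves_mul {L ω : ℝ} (hω : 2 ≤ ω) (hω' : ω ≤ 3) (hL : 2 / 3 ≤ L) :
    L ^ (ω - 2) ≤ 3 / 2 * L :=
  calc L ^ (ω - 2) ≤ (3 / 2 * L) ^ (ω - 2) :=
        Real.rpow_le_rpow (by linarith) (by linarith) (by linarith)
    _ ≤ (3 / 2 * L) ^ (1 : ℝ) := Real.rpow_le_rpow_of_exponent_le (by linarith) (by linarith)
    _ = _ := Real.rpow_one _

/-- The running times for a sketch with `c` rows. -/
lemma time_bounds {K ω : ℝ} (hω : 2 ≤ ω) (hK : 0 ≤ K)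
    (h : ∀ k : ℕ, ProductInTime k k k (K * (k : ℝ) ^ ω)) (hn : 0 < n) (hq : 0 < q) (hm : 0 < m)
    (hc : 0 < c) {T : ℝ}
    (hT : (8 * K + 9) * (m * n + n * q + q * m) * (c : ℝ) ^ (ω - 2) ≤ T) :
    (c ≤ min n (min q m) ∨ ω = 3 → SketchedProductInTime n q m c T) ∧
      (min n (min q m) < c → ProductInTime n q m T) := by
  refine ⟨?_, fun hlt => ?_⟩
  · rintro (hle | rfl)
    · exact (sketchedProductInTime_of_le_min hω hK h hc hle).mono hT
    · have h₁ := h 1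
      rw [Nat.cast_one, Real.one_rpow, mul_one] at h₁
      refine (sketchedProductInTime_cubic hK h₁ hn hm hc).mono (le_trans (le_of_eq ?_) hT)
      norm_num
  · refine (productInTime_min hω hK h hn hq hm).mono (le_trans ?_ hT)
    gcongr

lemma two_thirds_le_log {x : ℝ} (hx : 2 ≤ x) : 2 / 3 ≤ Real.log x := by
  have := Real.log_le_log (by norm_num) hx
  linarith [Real.log_two_gt_d9]

end Time

end TugOfWar

open TugOfWar
theorem theorem4p2 :
    ∃ κ : ℝ, 0 < κ ∧ ∀ ω : ℝ, 2 ≤ ω → ω ≤ 3 → IsMatMulExponent ω →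
      ∃ K : ℝ, 0 < K ∧ ∀ n q m : ℕ, 0 < n → 0 < q → 0 < m →
        ∀ (A : Matrix (Fin n) (Fin q) ℝ) (B : Matrix (Fin q) (Fin m) ℝ) (ε δ : ℝ),
          0 < ε → 0 < δ → δ < 1 →
          -- approximation in max-norm
          (let X : ℝ := max 1 (entryNorm 2 ⊤ A ^ 2 * entryNorm 2 ⊤ B.transpose ^ 2 / ε ^ 2)
           let c : ℕ := ⌈κ * X * Real.log (2 * (n * m) / δ)⌉₊
           let T : ℝ :=
             K * (m * n + n * q + q * m) * (X * Real.log (2 * (n * m) / δ)) ^ (ω - 2)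
           ENNReal.ofReal (1 - δ) ≤
              signProb c q
                {h | maxNorm (A * (sketch h).transpose * sketch h * B - A * B) ≤ ε} ∧
            (c ≤ min n (min q m) ∨ ω = 3 → SketchedProductInTime n q m c T) ∧
            (min n (min q m) < c → ProductInTime n q m T)) ∧
          -- approximation in Frobenius norm
          (let X : ℝ := max 1 (frobNorm A ^ 2 * frobNorm B ^ 2 / ε ^ 2)
           let c : ℕ := ⌈κ * X * Real.log (2 / δ)⌉₊
           let T : ℝ := K * (m * n + n * q + q * m) * X ^ (ω - 2) * Real.log (2 / δ)
           ENNReal.ofReal (1 - δ) ≤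
              signProb c q
                {h | frobNorm (A * (sketch h).transpose * sketch h * B - A * B) ≤ ε} ∧
            (c ≤ min n (min q m) ∨ ω = 3 → SketchedProductInTime n q m c T) ∧
            (min n (min q m) < c → ProductInTime n q m T)) := by
  refine ⟨10 ^ 6, by norm_num, fun ω hω hω' hexp => ?_⟩
  obtain ⟨K, hK, hmul⟩ := hexp.exists_bound
  -- The factor 2000000 covers `1000002 * (3 / 2)`, needed in the Frobenius case.
  refine ⟨2000000 * (8 * K + 9), by positivity, fun n q m hn hq hm A B ε δ hε hδ hδ' => ⟨?_, ?_⟩⟩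
  · intro X c T
    have hX : 1 ≤ X := le_max_left _ _
    have hnm : (1 : ℝ) ≤ n * m := by exact_mod_cast Nat.mul_pos hn hm
    have harg : 2 ≤ 2 * (n * m) / δ := by
      rw [le_div_iff₀ hδ]
      nlinarith
    have hL := two_thirds_le_log harg
    have hexpL : Real.exp (-Real.log (2 * (n * m) / δ)) = δ / (2 * (n * m)) := by
      rw [Real.exp_neg, Real.exp_log (by linarith), inv_div]
    refine ⟨le_signProb_maxNorm A B hε hX hL (le_max_right _ _) (le_of_eq ?_),
      time_bounds hω hK hmul hn hq hm (Nat.ceil_pos.2 (by positivity)) ?_⟩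
    · rw [hexpL]
      field_simp
    · have h₁ := rpow_ceil_le hω hω' hX hL
      have h₂ : 0 ≤ (X * Real.log (2 * (n * m) / δ)) ^ (ω - 2) :=
        Real.rpow_nonneg (by positivity) _
      calc _ ≤ (8 * K + 9) * (m * n + n * q + q * m) *
            (2000000 * (X * Real.log (2 * (n * m) / δ)) ^ (ω - 2)) := by
            refine mul_le_mul_of_nonneg_left ?_ (by positivity)
            linarith
        _ = T := by ring
  · intro X c T
    have hX : 1 ≤ X := le_max_left _ _
    have harg : 2 ≤ 2 / δ := by
      rw [le_div_iff₀ hδ]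
      linarith
    have hL := two_thirds_le_log harg
    have hexpL : Real.exp (-Real.log (2 / δ)) = δ / 2 := by
      rw [Real.exp_neg, Real.exp_log (by linarith), inv_div]
    refine ⟨le_signProb_frobNorm A B hε hX hL (le_max_right _ _) (le_of_eq ?_),
      time_bounds hω hK hmul hn hq hm (Nat.ceil_pos.2 (by positivity)) ?_⟩
    · rw [hexpL]
      ring
    · have h₁ := rpow_ceil_le hω hω' hX hL
      have hX0 : 0 ≤ X ^ (ω - 2) := Real.rpow_nonneg (by linarith) _
      have h₂ := mul_le_mul_of_nonneg_left (rpow_le_three_halves_mul hω hω' hL) hX0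
      have h₃ : 0 ≤ X ^ (ω - 2) * Real.log (2 / δ) := mul_nonneg hX0 (by linarith)
      rw [Real.mul_rpow (by linarith) (by linarith)] at h₁
      calc _ ≤ (8 * K + 9) * (m * n + n * q + q * m) *
            (2000000 * (X ^ (ω - 2) * Real.log (2 / δ))) := by
            refine mul_le_mul_of_nonneg_left ?_ (by positivity)
            linarith
        _ = T := by ring
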